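/- Let $\lambda_0>1$ and $M=\lambda_0\,\mathrm{Id}$ on $\mathbb R^n$. Let $Q_0\subset\mathbb R^n$ be a compact set containing the origin in its interior (for instance, when $M$ is a dilation matrix of $\mathbb Z^n$, a translate of a self-affine tile of $M$), and put $Q_l(x)=M^{-l}Q_0+x$. Let $s>0$ and let $k$ be a nonnegative integer with $k+1>s$. For $f\in L^\infty(\mathbb R^n)$ (complex valued) let $$\mathrm{osc}^k_\infty f(x,l)=\inf_{P}\ \operatorname*{ess\,sup}_{y\in Q_l(x)}|f(y)-P(y)|,$$ the infimum being over all polynomials $P$ of degree at most $k$, and write $f\in C^s(x)$ if $\sup_{l\ge 0}\lambda_0^{ls}\,\mathrm{osc}^k_\infty f(x,l)<\infty$. Let $\varphi$ be a Schwartz function on $\mathbb R^n$ whose Fourier transform $\hat\varphi(\xi)=\int\varphi(x)e^{-ix\cdot\xi}\,dx$ satisfies $\operatorname{supp}\hat\varphi\subset\{|\xi|\le 1\}$ and $\hat\varphi(\xi)=1$ for $|\xi|\le\lambda_0^{-1}$. Put $\psi(x)=\lambda_0^n\varphi(\lambda_0x)-\varphi(x)$, $\varphi_l(x)=\lambda_0^{ln}\varphi(\lambda_0^lx)$,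 $\psi_l(x)=\lambda_0^{ln}\psi(\lambda_0^lx)$, $S_lf=f*\varphi_l$ and $f_l=f*\psi_l$ for $l=0,1,2,\dots$. Then for every $f\in L^\infty(\mathbb R^n)$ and every $x\in\mathbb R^n$: 1. $f\in C^s(x)$ if and only if there is a constant $C>0$ such that for all $l\ge 0$ and almost every $y\in\mathbb R^n$ $$|f(y)-S_lf(y)|\le C(\lambda_0^{-l}+|x-y|)^s .$$ 2. If $f\in C^s(x)$, then there is a constant $C>0$ such that $|f_l(y)|\le C(\lambda_0^{-l}+|x-y|)^s$ for all $l\ge0$ and all $y\in\mathbb R^n$. 3. Conversely, if for some $s'$ with $0<s'<s$ there is a constant $C>0$ such that $|f_l(y)|\le C\lambda_0^{-ls}(1+\lambda_0^l|x-y|)^{s'}$ for all $l\ge 0$ and all $y\in\mathbb R^n$, then $f\in C^s(x)$. -/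

import Mathlib

open MeasureTheory
open scoped ENNReal FourierTransform

noncomputable section

namespace PointwiseHolder

/-- The cell `Q_l(x) = M^{-l} Q₀ + x` for the dilation `M = lam • Id`. -/
def cell {n : ℕ} (lam : ℝ) (Q₀ : Set (EuclideanSpace ℝ (Fin n))) (l : ℕ)
    (x : EuclideanSpace ℝ (Fin n)) : Set (EuclideanSpace ℝ (Fin n)) :=
  {y | lam ^ l • (y - x) ∈ Q₀}

/-- A polynomial with complex coefficients, as a function on `ℝⁿ`. -/
def polyFun {n : ℕ} (P : MvPolynomial (Fin n) ℂ) (y : EuclideanSpace ℝ (Fin n)) : ℂ :=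
  MvPolynomial.eval (fun i => (y i : ℂ)) P

/-- The local oscillation `osc_p^k f(x, l)`: the infimum over all polynomials `P` of degree at
most `k` of the `L^p` norm of `f - P` on `Q_l(x)` with respect to normalized Lebesgue measure
(`ProbabilityTheory.cond volume Q` is `|Q|⁻¹` times Lebesgue measure on `Q`).
For `p = ∞` it is the essential supremum over `Q_l(x)`. -/
def osc {n : ℕ} (lam : ℝ) (Q₀ : Set (EuclideanSpace ℝ (Fin n))) (k : ℕ) (p : ℝ≥0∞)
    (f : EuclideanSpace ℝ (Fin n) → ℂ) (x : EuclideanSpace ℝ (Fin n)) (l : ℕ) : ℝ≥0∞ :=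
  ⨅ (P : MvPolynomial (Fin n) ℂ) (_ : P.totalDegree ≤ k),
    eLpNorm (fun y => f y - polyFun P y) p (ProbabilityTheory.cond volume (cell lam Q₀ l x))

/-- `f ∈ T^s_{pq}(x)`, for `0 < s < k + 1`: the sequence `lam^{l s} osc_p^k f(x, l)`, `l ≥ 0`, has
finite `ℓ^q` norm (for `q = ∞`: finite supremum). -/
def MemT {n : ℕ} (lam : ℝ) (Q₀ : Set (EuclideanSpace ℝ (Fin n))) (k : ℕ) (p q : ℝ≥0∞) (s : ℝ)
    (f : EuclideanSpace ℝ (Fin n) → ℂ) (x : EuclideanSpace ℝ (Fin n)) : Prop :=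
  eLpNorm (fun l : ℕ => ENNReal.ofReal (lam ^ ((l : ℝ) * s)) * osc lam Q₀ k p f x l) q
    Measure.count < ∞

/-- `f ∈ C^s(x)`, that is `f ∈ T^s_{∞∞}(x)`. -/
def MemC {n : ℕ} (lam : ℝ) (Q₀ : Set (EuclideanSpace ℝ (Fin n))) (k : ℕ) (s : ℝ)
    (f : EuclideanSpace ℝ (Fin n) → ℂ) (x : EuclideanSpace ℝ (Fin n)) : Prop :=
  MemT lam Q₀ k ∞ ∞ s f x

/-- The Fourier transform `ξ ↦ ∫ φ(x) e^{-i x·ξ} dx` (Mathlib's `𝓕` has kernel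
`e^{-2π i x·ξ}`). -/
def hat {n : ℕ} (φ : SchwartzMap (EuclideanSpace ℝ (Fin n)) ℂ)
    (ξ : EuclideanSpace ℝ (Fin n)) : ℂ :=
  𝓕 (φ : EuclideanSpace ℝ (Fin n) → ℂ) ((2 * Real.pi)⁻¹ • ξ)

/-- `φ` is an admissible low-pass function: a Schwartz function whose Fourier transform is
supported in the unit ball and equals `1` on the ball of radius `lam⁻¹`. -/
def IsLowPass {n : ℕ} (lam : ℝ) (φ : SchwartzMap (EuclideanSpace ℝ (Fin n)) ℂ) : Prop :=
  tsupport (hat φ) ⊆ {ξ | ‖ξ‖ ≤ 1} ∧ ∀ ξ, ‖ξ‖ ≤ lam⁻¹ → hat φ ξ = 1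

/-- `g_l(x) = lam^{l n} g(lam^l x)`. -/
def dilate {n : ℕ} (lam : ℝ) (l : ℕ) (g : EuclideanSpace ℝ (Fin n) → ℂ)
    (x : EuclideanSpace ℝ (Fin n)) : ℂ :=
  (lam : ℂ) ^ (l * n) * g (lam ^ l • x)

/-- `ψ(x) = lam^n φ(lam x) - φ(x)`. -/
def bandPass {n : ℕ} (lam : ℝ) (φ : EuclideanSpace ℝ (Fin n) → ℂ)
    (x : EuclideanSpace ℝ (Fin n)) : ℂ :=
  (lam : ℂ) ^ n * φ (lam • x) - φ x

/-- Convolution `(f * g)(y) = ∫ f(t) g(y - t) dt` on `ℝⁿ`. -/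
def conv {n : ℕ} (f g : EuclideanSpace ℝ (Fin n) → ℂ) : EuclideanSpace ℝ (Fin n) → ℂ :=
  convolution f g (ContinuousLinearMap.mul ℂ ℂ) volume

/-- The Littlewood–Paley partial sum `S_l f = f * φ_l`. -/
def partialSum {n : ℕ} (lam : ℝ) (φ f : EuclideanSpace ℝ (Fin n) → ℂ) (l : ℕ) :
    EuclideanSpace ℝ (Fin n) → ℂ :=
  conv f (dilate lam l φ)

/-- The Littlewood–Paley block `f_l = f * ψ_l`. -/
def block {n : ℕ} (lam : ℝ) (φ f : EuclideanSpace ℝ (Fin n) → ℂ) (l : ℕ) :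
    EuclideanSpace ℝ (Fin n) → ℂ :=
  conv f (dilate lam l (bandPass lam φ))

end PointwiseHolder

end

noncomputable section

namespace PointwiseHolder

/-! Write λ for `lam`, q = λ^(-s), θ = λ^(-(k+1)); the condition s < k + 1 says θ < q. Cells at
level l are comparable with balls of radius λ^(-l) about x.

From f ∈ C^s(x) to the bounds: there are polynomials P_j with |f - P_j| ≲ q^j on the j-th cell.
Consecutive P_j differ little on a small ball, and a polynomial of degree at most k that is small on
a ball grows at most like a k-th power away from it. Since θ < q, these differences sum to |f - P_j|
≲ q^j (1 + λ^j |y - x|)^(k+1) almost everywhere (`exists_global_bound_sub_polyFun`). As φ̂ = 1 near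
0, convolution with φ_l fixes polynomials, so S_l f - P_j = (f - P_j) * φ_l satisfies the same bound
for j ≤ l. Choosing j with λ^(-j) comparable to λ^(-l) + |x - y| bounds both f - S_l f and f_l =
S_{l+1} f - S_l f (`MemC.exists_bounds`).

Conversely, f_j is band-limited, hence f_j = f_j * φ_{j+2}, and Taylor expansion of the kernel
approximates it by a polynomial of degree k up to q^j (λ^j |y - x|)^(k+1). On the l-th cell these
errors sum over j < l to O(q^l), again by θ < q (`exists_poly_near_partialSum`). It remains to have
f - S_l f = O(q^l) on the cell (`memC_of_block_bounds`). In the first equivalence this is the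
hypothesis; under block decay with s' < s the tail Σ_{j ≥ l} f_j is geometric, and its sum is f -
S_l f almost everywhere because φ_l is an approximate identity. -/

/-- Euclidean space of dimension `n`. -/
abbrev Vec (n : ℕ) : Type := EuclideanSpace ℝ (Fin n)

/-! ### Rescaled kernels and weighted convolution bounds. -/

/-- The `L¹`-normalized rescaling `z ↦ aⁿ h(a z)`. -/
def rescale {n : ℕ} (a : ℝ) (h : Vec n → ℂ) (z : Vec n) : ℂ := (a : ℂ) ^ n * h (a • z)

lemma dilate_eq_rescale {n : ℕ} (lam : ℝ) (l : ℕ) (g : Vec n → ℂ) :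
    dilate lam l g = rescale (lam ^ l) g := by
  funext z
  simp [dilate, rescale, pow_mul]

lemma conv_apply {n : ℕ} (f g : Vec n → ℂ) (y : Vec n) :
    conv f g y = ∫ t, f t * g (y - t) := rfl

lemma integrable_schwartz_weight {n : ℕ} (φ : SchwartzMap (Vec n) ℂ) (K : ℕ) :
    Integrable (fun u => ‖φ u‖ * (1 + ‖u‖) ^ K) := by
  have h : ∀ u : Vec n, ‖φ u‖ * (1 + ‖u‖) ^ K =
      ∑ m ∈ Finset.range (K + 1), (K.choose m : ℝ) * (‖u‖ ^ m * ‖φ u‖) := by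
    intro u
    rw [add_comm, add_pow, Finset.mul_sum]
    refine Finset.sum_congr rfl fun m _ => ?_
    simp; ring
  simp_rw [h]
  exact integrable_finsetSum _ fun m _ => (φ.integrable_pow_mul volume m).const_mul _

lemma integral_rescale {n : ℕ} {F : Type*} [NormedAddCommGroup F] [NormedSpace ℝ F]
    {a : ℝ} (ha : 0 < a) (y : Vec n) (h : Vec n → F) :
    ∫ t, a ^ n • h (a • (y - t)) = ∫ u, h u := by
  rw [integral_smul, integral_sub_left_eq_self (fun u => h (a • u)) volume y,
    Measure.integral_comp_smul, smul_smul]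
  have : (a ^ n * |(a ^ Module.finrank ℝ (Vec n))⁻¹|) = 1 := by
    rw [abs_of_pos (by positivity)]
    simp only [finrank_euclideanSpace, Fintype.card_fin]
    field_simp
  rw [this, one_smul]

lemma integrable_rescale {n : ℕ} {F : Type*} [NormedAddCommGroup F] [NormedSpace ℝ F]
    {a : ℝ} (ha : 0 < a) (y : Vec n) {h : Vec n → F} (hh : Integrable h) :
    Integrable fun t => a ^ n • h (a • (y - t)) := by
  have h1 : Integrable fun t => h (a • t) := hh.comp_smul ha.ne'
  exact (h1.comp_sub_left y).smul _

/-- A Peetre-type inequality: moving the weight of scale b from t to y costs only a factor measured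
at the finer scale a, which a Schwartz kernel absorbs. -/
lemma one_add_mul_le {n : ℕ} {a b : ℝ} (hb : 0 ≤ b) (hab : b ≤ a) (x y t : Vec n) :
    1 + b * ‖t - x‖ ≤ (1 + b * ‖y - x‖) * (1 + ‖a • (y - t)‖) := by
  rw [norm_smul, Real.norm_of_nonneg (hb.trans hab)]
  have h1 : ‖t - x‖ ≤ ‖y - x‖ + ‖y - t‖ := by
    have := norm_sub_le (y - x) (y - t)
    rwa [sub_sub_sub_cancel_left] at this
  have h2 : b * ‖t - x‖ ≤ b * ‖y - x‖ + a * ‖y - t‖ := by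
    calc b * ‖t - x‖ ≤ b * (‖y - x‖ + ‖y - t‖) := by gcongr
      _ ≤ _ := by rw [mul_add]; gcongr
  have h3 : 0 ≤ b * ‖y - x‖ * (a * ‖y - t‖) := by
    have := hb.trans hab
    positivity
  linarith

section kernel

variable {n : ℕ} {g h : Vec n → ℂ} {a b A : ℝ} {K : ℕ} {x : Vec n}

lemma norm_mul_rescale_le (hb : 0 ≤ b) (hab : b ≤ a) (hA : 0 ≤ A)
    (hgA : ∀ᵐ t, ‖g t‖ ≤ A * (1 + b * ‖t - x‖) ^ K) (y : Vec n) :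
    ∀ᵐ t, ‖g t * rescale a h (y - t)‖ ≤ A * (1 + b * ‖y - x‖) ^ K *
      (a ^ n • (‖h (a • (y - t))‖ * (1 + ‖a • (y - t)‖) ^ K)) := by
  filter_upwards [hgA] with t ht
  have ha : 0 ≤ a := hb.trans hab
  have e : ‖rescale a h (y - t)‖ = a ^ n * ‖h (a • (y - t))‖ := by
    simp [rescale, abs_of_nonneg ha]
  rw [norm_mul, e, smul_eq_mul]
  calc ‖g t‖ * (a ^ n * ‖h (a • (y - t))‖)
      ≤ (A * ((1 + b * ‖y - x‖) * (1 + ‖a • (y - t)‖)) ^ K) * (a ^ n * ‖h (a • (y - t))‖) := by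
        gcongr
        refine ht.trans ?_
        gcongr
        exact one_add_mul_le hb hab x y t
    _ = _ := by rw [mul_pow]; ring

lemma integrable_mul_rescale (hg : AEStronglyMeasurable g) (hh : Continuous h)
    (hint : Integrable fun u => ‖h u‖ * (1 + ‖u‖) ^ K) (ha : 0 < a) (hb : 0 ≤ b) (hab : b ≤ a)
    (hA : 0 ≤ A) (hgA : ∀ᵐ t, ‖g t‖ ≤ A * (1 + b * ‖t - x‖) ^ K) (y : Vec n) :
    Integrable fun t => g t * rescale a h (y - t) := by
  refine ((integrable_rescale ha y hint).const_mul (A * (1 + b * ‖y - x‖) ^ K)).mono' ?_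
    (norm_mul_rescale_le hb hab hA hgA y)
  refine hg.mul (Continuous.aestronglyMeasurable ?_)
  unfold rescale
  fun_prop

/-- Smoothing at a scale finer than 1/b preserves growth bounds centred at x, with a constant free
of a and b. Taking K = 0 gives plain sup bounds. -/
lemma norm_conv_rescale_le (hint : Integrable fun u => ‖h u‖ * (1 + ‖u‖) ^ K) (ha : 0 < a)
    (hb : 0 ≤ b) (hab : b ≤ a)
    (hA : 0 ≤ A) (hgA : ∀ᵐ t, ‖g t‖ ≤ A * (1 + b * ‖t - x‖) ^ K) (y : Vec n) :
    ‖conv g (rescale a h) y‖ ≤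
      (∫ u, ‖h u‖ * (1 + ‖u‖) ^ K) * A * (1 + b * ‖y - x‖) ^ K := by
  rw [conv_apply]
  refine (norm_integral_le_of_norm_le
    ((integrable_rescale ha y hint).const_mul (A * (1 + b * ‖y - x‖) ^ K))
    (norm_mul_rescale_le hb hab hA hgA y)).trans_eq ?_
  rw [integral_const_mul, integral_rescale ha y fun u => ‖h u‖ * (1 + ‖u‖) ^ K]
  ring

end kernel

lemma exists_ae_norm_le_of_memLp_top {n : ℕ} {f : Vec n → ℂ} (hf : MemLp f ∞ volume) :
    ∃ B : ℝ, 0 ≤ B ∧ ∀ᵐ t, ‖f t‖ ≤ B := by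
  refine ⟨(eLpNorm f ∞ volume).toReal, ENNReal.toReal_nonneg, ?_⟩
  filter_upwards [ae_le_eLpNormEssSup (f := f) (μ := volume)] with t ht
  rw [← eLpNorm_exponent_top] at ht
  have := ENNReal.toReal_mono hf.2.ne ht
  simpa using this

open Filter Topology LineDeriv

/-! ### Vanishing moments and reproduction of polynomials. -/

section moments

variable {n : ℕ}

/-- Multiplication by a coordinate is, up to a constant, differentiation of the Fourier transform,
and a locally constant function has zero derivative. -/
lemma fourier_coord_mul_eventually_eq_zero (g : SchwartzMap (Vec n) ℂ) (c : ℂ)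
    (hg : ∀ᶠ ξ in 𝓝 (0 : Vec n), 𝓕 g ξ = c) (i : Fin n) :
    ∃ G : SchwartzMap (Vec n) ℂ, (∀ u, G u = (u i : ℂ) * g u) ∧
      ∀ᶠ ξ in 𝓝 (0 : Vec n), 𝓕 G ξ = 0 := by
  set e : Vec n := EuclideanSpace.single i 1
  have htg : (fun u : Vec n => inner ℝ u e).HasTemperateGrowth :=
    ((innerSL ℝ).flip e).hasTemperateGrowth
  refine ⟨SchwartzMap.smulLeftCLM ℂ (fun u : Vec n => inner ℝ u e) g, fun u => ?_, ?_⟩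
  · rw [SchwartzMap.smulLeftCLM_apply_apply htg]
    simp [e, EuclideanSpace.inner_single_right]
  · have h := SchwartzMap.lineDerivOp_fourier_eq g e
    filter_upwards [hg.eventually_nhds] with ξ hξ
    have h1 : (∂_{e} (𝓕 g)) ξ = 0 := by
      change fderiv ℝ (𝓕 (g : Vec n → ℂ)) ξ e = 0
      have : fderiv ℝ (𝓕 (g : Vec n → ℂ)) ξ = 0 := by
        have h2 : 𝓕 (g : Vec n → ℂ) =ᶠ[𝓝 ξ] fun _ => c := hξ
        rw [h2.fderiv_eq]
        simp
      simp [this]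
    rw [h, FourierTransform.fourier_smul] at h1
    simpa [Real.pi_ne_zero] using h1

lemma fourier_polyFun_mul_eventually_eq (Q : MvPolynomial (Fin n) ℂ) :
    ∀ (g : SchwartzMap (Vec n) ℂ) (c : ℂ), (∀ᶠ ξ in 𝓝 (0 : Vec n), 𝓕 g ξ = c) →
    ∃ G : SchwartzMap (Vec n) ℂ, (∀ u, G u = polyFun Q u * g u) ∧
      ∀ᶠ ξ in 𝓝 (0 : Vec n), 𝓕 G ξ = polyFun Q 0 * c := by
  induction Q using MvPolynomial.induction_on with
  | C a =>
    intro g c hg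
    refine ⟨a • g, fun u => by simp [polyFun], ?_⟩
    filter_upwards [hg] with ξ hξ
    rw [FourierTransform.fourier_smul]
    simp [polyFun, hξ]
  | add p q hp hq =>
    intro g c hg
    obtain ⟨G₁, h₁, h₁'⟩ := hp g c hg
    obtain ⟨G₂, h₂, h₂'⟩ := hq g c hg
    refine ⟨G₁ + G₂, fun u => ?_, ?_⟩
    · simp [h₁, h₂, polyFun, add_mul]
    · filter_upwards [h₁', h₂'] with ξ e₁ e₂
      rw [FourierTransform.fourier_add]
      simp [e₁, e₂, polyFun, add_mul]
  | mul_X p i hp =>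
    intro g c hg
    -- The factor `X i` is absorbed into g first, which replaces c by 0; this is why the induction
    -- quantifies over g and c.
    obtain ⟨g', hg', hg''⟩ := fourier_coord_mul_eventually_eq_zero g c hg i
    obtain ⟨G, h, h'⟩ := hp g' 0 hg''
    refine ⟨G, fun u => ?_, ?_⟩
    · simp [h, hg', polyFun, mul_assoc]
    · filter_upwards [h'] with ξ e
      rw [e]
      simp [polyFun]

lemma polyFun_comp_affine (P : MvPolynomial (Fin n) ℂ) (y : Vec n) (b : ℝ) (u : Vec n) :
    polyFun (MvPolynomial.aeval
      (fun i => MvPolynomial.C (y i : ℂ) + MvPolynomial.C (b : ℂ) * MvPolynomial.X i) P) u =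
      polyFun P (y + b • u) := by
  simp only [polyFun, MvPolynomial.aeval_def]
  rw [← MvPolynomial.coe_eval₂Hom, ← RingHom.comp_apply]
  congr 1
  apply MvPolynomial.ringHom_ext <;> intros <;> simp

lemma IsLowPass.fourier_eventually_eq_one {lam : ℝ} (hlam : 1 < lam)
    {φ : SchwartzMap (Vec n) ℂ} (hφ : IsLowPass lam φ) :
    ∀ᶠ ξ in 𝓝 (0 : Vec n), 𝓕 φ ξ = 1 := by
  have h0 : 0 < lam⁻¹ := by positivity
  have hpi := Real.two_pi_pos
  filter_upwards [Metric.ball_mem_nhds (0 : Vec n) (ε := (2 * Real.pi)⁻¹ * lam⁻¹) (by positivity)]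
    with ξ hξ
  rw [mem_ball_zero_iff] at hξ
  have h1 := hφ.2 ((2 * Real.pi) • ξ) (by
    rw [norm_smul, Real.norm_of_nonneg hpi.le]
    calc 2 * Real.pi * ‖ξ‖ ≤ 2 * Real.pi * ((2 * Real.pi)⁻¹ * lam⁻¹) := by gcongr
      _ = lam⁻¹ := by field_simp)
  rw [hat, smul_smul, inv_mul_cancel₀ hpi.ne', one_smul] at h1
  exact h1

/-- A low-pass function has integral one and vanishing higher moments. -/
lemma IsLowPass.integral_polyFun_mul {lam : ℝ} (hlam : 1 < lam)
    {φ : SchwartzMap (Vec n) ℂ} (hφ : IsLowPass lam φ) (Q : MvPolynomial (Fin n) ℂ) :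
    Integrable (fun u => polyFun Q u * φ u) ∧ ∫ u, polyFun Q u * φ u = polyFun Q 0 := by
  obtain ⟨G, h, h'⟩ := fourier_polyFun_mul_eventually_eq Q φ 1
    (hφ.fourier_eventually_eq_one hlam)
  have h0 := h'.self_of_nhds
  have hG : (fun u => polyFun Q u * φ u) = G := by funext u; rw [h u]
  rw [hG]
  refine ⟨G.integrable, ?_⟩
  rw [mul_one] at h0
  rw [← h0, SchwartzMap.fourier_coe, Real.fourier_eq]
  simp

/-- Rescaled low-pass functions reproduce polynomials. -/
lemma IsLowPass.conv_polyFun {lam : ℝ} (hlam : 1 < lam)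
    {φ : SchwartzMap (Vec n) ℂ} (hφ : IsLowPass lam φ) (P : MvPolynomial (Fin n) ℂ)
    {a : ℝ} (ha : 0 < a) (y : Vec n) :
    Integrable (fun t => polyFun P t * rescale a φ (y - t)) ∧
      conv (polyFun P) (rescale a φ) y = polyFun P y := by
  -- The moment identity is applied to u ↦ P(y - a⁻¹u), whose value at 0 is P(y).
  obtain ⟨h1, h2⟩ := hφ.integral_polyFun_mul hlam (MvPolynomial.aeval
      (fun i => MvPolynomial.C (y i : ℂ) + MvPolynomial.C ((-a⁻¹ : ℝ) : ℂ) * MvPolynomial.X i) P)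
  simp_rw [polyFun_comp_affine] at h1 h2
  have e : (fun t => polyFun P t * rescale a φ (y - t)) = fun t => a ^ n •
      (fun u => polyFun P (y + (-a⁻¹) • u) * φ u) (a • (y - t)) := by
    funext t
    have : y + (-a⁻¹) • a • (y - t) = t := by
      rw [smul_smul, neg_mul, inv_mul_cancel₀ ha.ne']
      simp
    simp only [this, rescale, Complex.real_smul]
    push_cast
    ring
  rw [conv_apply, e]
  refine ⟨integrable_rescale ha y h1, ?_⟩
  rw [integral_rescale ha y fun u => polyFun P (y + (-a⁻¹) • u) * φ u, h2]
  simp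

end moments

/-! ### Band-limited functions are fixed by finer smoothing. -/

section reproducing

variable {n : ℕ}

/-- The rescaling of a Schwartz function as a Schwartz function. -/
lemma exists_schwartz_rescale (φ : SchwartzMap (Vec n) ℂ) {a : ℝ} (ha : 0 < a) :
    ∃ Φ : SchwartzMap (Vec n) ℂ, ⇑Φ = rescale a φ := by
  refine ⟨(a : ℂ) ^ n • SchwartzMap.compCLMOfContinuousLinearEquiv ℂ
    (ContinuousLinearEquiv.smulLeft (Units.mk0 a ha.ne')) φ, ?_⟩
  funext u
  simp [rescale, Units.smul_def]

lemma fourier_rescale (φ : Vec n → ℂ) {a : ℝ} (ha : 0 < a) (ξ : Vec n) :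
    𝓕 (rescale a φ) ξ = 𝓕 φ (a⁻¹ • ξ) := by
  rw [Real.fourier_eq, Real.fourier_eq]
  -- With base point 0 the change of variables reverses sign, so the integrand is reflected
  -- beforehand.
  have := integral_rescale ha 0 fun u =>
    Real.fourierChar (-inner ℝ (-u) (a⁻¹ • ξ)) • φ (-u)
  rw [integral_neg_eq_self (fun u => Real.fourierChar (-inner ℝ u (a⁻¹ • ξ)) • φ u) volume] at this
  rw [← this]
  congr 1
  funext t
  have h : (inner ℝ (a • t) (a⁻¹ • ξ) : ℝ) = inner ℝ t ξ := by
    rw [inner_smul_left, inner_smul_right]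
    simp only [conj_trivial]
    field_simp
  simp only [zero_sub, smul_neg, neg_neg, h, rescale, Circle.smul_def, Complex.real_smul,
    smul_eq_mul]
  push_cast
  ring

lemma IsLowPass.fourier_eq_zero {lam : ℝ} {φ : SchwartzMap (Vec n) ℂ} (hφ : IsLowPass lam φ)
    {ξ : Vec n} (hξ : 1 < ‖(2 * Real.pi) • ξ‖) : 𝓕 (φ : Vec n → ℂ) ξ = 0 := by
  by_contra h
  have h1 : (2 * Real.pi) • ξ ∈ tsupport (hat φ) := by
    apply subset_tsupport
    rw [Function.mem_support, hat, smul_smul, inv_mul_cancel₀ Real.two_pi_pos.ne', one_smul]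
    exact h
  exact absurd (hφ.1 h1) (by simpa using hξ)

lemma IsLowPass.fourier_eq_one {lam : ℝ} {φ : SchwartzMap (Vec n) ℂ} (hφ : IsLowPass lam φ)
    {ξ : Vec n} (hξ : ‖(2 * Real.pi) • ξ‖ ≤ lam⁻¹) : 𝓕 (φ : Vec n → ℂ) ξ = 1 := by
  have := hφ.2 _ hξ
  rwa [hat, smul_smul, inv_mul_cancel₀ Real.two_pi_pos.ne', one_smul] at this

/-- On the Fourier side the coarse factor is supported in |2πξ| ≤ a, where |2πξ|/b ≤ λ⁻¹ and the
fine factor equals 1. -/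
lemma IsLowPass.conv_rescale_rescale {lam : ℝ} (hlam : 1 < lam) {φ : SchwartzMap (Vec n) ℂ}
    (hφ : IsLowPass lam φ) {a b : ℝ} (ha : 0 < a) (hab : lam * a ≤ b) :
    conv (rescale a φ) (rescale b φ) = rescale a φ := by
  have hb : 0 < b := lt_of_lt_of_le (by positivity) hab
  obtain ⟨Φ, hΦ⟩ := exists_schwartz_rescale φ ha
  obtain ⟨Ψ, hΨ⟩ := exists_schwartz_rescale φ hb
  have key : SchwartzMap.convolution (ContinuousLinearMap.mul ℂ ℂ) Φ Ψ = Φ := by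
    have hF : 𝓕 (SchwartzMap.convolution (ContinuousLinearMap.mul ℂ ℂ) Φ Ψ) = 𝓕 Φ := by
      ext ξ
      rw [SchwartzMap.fourier_convolution, SchwartzMap.pairing_apply_apply,
        SchwartzMap.fourier_coe, SchwartzMap.fourier_coe, hΦ, hΨ, fourier_rescale _ ha,
        fourier_rescale _ hb, ContinuousLinearMap.mul_apply']
      by_cases hξ : 1 < ‖(2 * Real.pi) • a⁻¹ • ξ‖
      · simp [hφ.fourier_eq_zero hξ]
      · rw [hφ.fourier_eq_one (ξ := b⁻¹ • ξ), mul_one]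
        push Not at hξ
        have e : (2 * Real.pi) • b⁻¹ • ξ = (b⁻¹ * a) • (2 * Real.pi) • a⁻¹ • ξ := by
          simp only [smul_smul]
          congr 1
          field_simp
        rw [e, norm_smul, Real.norm_of_nonneg (by positivity)]
        calc b⁻¹ * a * ‖(2 * Real.pi) • a⁻¹ • ξ‖ ≤ b⁻¹ * a * 1 := by gcongr
          _ ≤ lam⁻¹ := by
            rw [mul_one, inv_mul_eq_div, div_le_iff₀ hb, inv_mul_eq_div, le_div_iff₀ (by positivity)]
            linarith
    have := congrArg (fun F : SchwartzMap (Vec n) ℂ => 𝓕⁻ F) hF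
    simpa using this
  funext y
  have := SchwartzMap.convolution_apply (ContinuousLinearMap.mul ℂ ℂ) Φ Ψ y
  rw [key, hΦ, hΨ] at this
  exact this.symm

/-- For merely bounded f the Fourier identity is used on the two kernels only; associativity
transfers it to f. -/
lemma conv_assoc_of_bounded {f : Vec n → ℂ} (hf : MemLp f ∞ volume)
    (Φ Ψ : SchwartzMap (Vec n) ℂ) : conv (conv f Φ) Ψ = conv f (conv Φ Ψ) := by
  obtain ⟨B, hB0, hB⟩ := exists_ae_norm_le_of_memLp_top hf
  have bdd : ∀ {G : Vec n → ℝ} (y : Vec n), Integrable G →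
      Integrable fun t => ‖f t‖ * G (y - t) := by
    intro G y hG
    refine (hG.comp_sub_left y).bdd_mul hf.1.norm (c := B) ?_
    filter_upwards [hB] with t ht
    simpa using ht
  funext y
  refine convolution_assoc (ContinuousLinearMap.mul ℂ ℂ) (ContinuousLinearMap.mul ℂ ℂ)
    (ContinuousLinearMap.mul ℂ ℂ) (ContinuousLinearMap.mul ℂ ℂ) (fun a b c => ?_) hf.1
    Φ.continuous.aestronglyMeasurable Ψ.continuous.aestronglyMeasurable ?_ ?_ ?_
  · simp [mul_assoc]
  · refine Eventually.of_forall fun t => ?_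
    refine (Φ.integrable.comp_sub_left t).bdd_mul hf.1 (c := B) hB
  · exact Φ.integrable.norm.ae_convolution_exists (ContinuousLinearMap.mul ℝ ℝ)
      Ψ.integrable.norm
  · exact bdd y (Φ.integrable.norm.integrable_convolution (ContinuousLinearMap.mul ℝ ℝ)
      Ψ.integrable.norm)

/-- A smoothed function is reproduced by smoothing at a finer scale. -/
lemma IsLowPass.conv_conv_rescale {lam : ℝ} (hlam : 1 < lam) {φ : SchwartzMap (Vec n) ℂ}
    (hφ : IsLowPass lam φ) {f : Vec n → ℂ} (hf : MemLp f ∞ volume) {a b : ℝ} (ha : 0 < a)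
    (hab : lam * a ≤ b) :
    conv (conv f (rescale a φ)) (rescale b φ) = conv f (rescale a φ) := by
  have hb : 0 < b := lt_of_lt_of_le (by positivity) hab
  obtain ⟨Φ, hΦ⟩ := exists_schwartz_rescale φ ha
  obtain ⟨Ψ, hΨ⟩ := exists_schwartz_rescale φ hb
  have h := hφ.conv_rescale_rescale hlam ha hab
  rw [← hΦ, ← hΨ] at h ⊢
  rw [conv_assoc_of_bounded hf, h]

end reproducing

/-! ### Partial sums and blocks of a bounded function. -/

section linearity

variable {n : ℕ}

lemma integrable_mul_schwartz_rescale {f : Vec n → ℂ} (hf : MemLp f ∞ volume)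
    (φ : SchwartzMap (Vec n) ℂ) {a : ℝ} (ha : 0 < a) (y : Vec n) :
    Integrable fun t => f t * rescale a φ (y - t) := by
  obtain ⟨B, hB0, hB⟩ := exists_ae_norm_le_of_memLp_top hf
  exact integrable_mul_rescale (K := 0) (x := 0) (b := a) hf.1 φ.continuous
    (integrable_schwartz_weight φ 0) ha ha.le le_rfl hB0 (by simpa using hB) y

lemma block_eq {f : Vec n → ℂ} (hf : MemLp f ∞ volume) (φ : SchwartzMap (Vec n) ℂ) {lam : ℝ}
    (hlam : 1 < lam) (l : ℕ) (y : Vec n) :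
    block lam φ f l y = partialSum lam φ f (l + 1) y - partialSum lam φ f l y := by
  have h0 : 0 < lam := by linarith
  simp only [block, partialSum, conv_apply]
  rw [dilate_eq_rescale, dilate_eq_rescale, dilate_eq_rescale,
    ← integral_sub (integrable_mul_schwartz_rescale hf φ (by positivity) y)
      (integrable_mul_schwartz_rescale hf φ (by positivity) y)]
  refine integral_congr_ae (Eventually.of_forall fun t => ?_)
  simp only [rescale, bandPass, smul_smul, pow_succ' lam l]
  push_cast
  ring

lemma norm_partialSum_le {f : Vec n → ℂ} {B : ℝ} (hB0 : 0 ≤ B) (hB : ∀ᵐ t, ‖f t‖ ≤ B)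
    (φ : SchwartzMap (Vec n) ℂ) {lam : ℝ} (hlam : 1 < lam) (l : ℕ) (y : Vec n) :
    ‖partialSum lam φ f l y‖ ≤ (∫ u, ‖φ u‖) * B := by
  have h0 : 0 < lam := by linarith
  rw [partialSum, dilate_eq_rescale]
  simpa using norm_conv_rescale_le (K := 0) (x := 0) (b := lam ^ l) (a := lam ^ l)
    (integrable_schwartz_weight φ 0) (by positivity) (by positivity) le_rfl hB0
    (by simpa using hB) y

lemma aestronglyMeasurable_partialSum {f : Vec n → ℂ} (hf : MemLp f ∞ volume)
    (φ : SchwartzMap (Vec n) ℂ) {lam : ℝ} (hlam : 1 < lam) (l : ℕ) :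
    AEStronglyMeasurable (partialSum lam φ f l) := by
  have h0 : 0 < lam := by linarith
  obtain ⟨Φ, hΦ⟩ := exists_schwartz_rescale φ (a := lam ^ l) (by positivity)
  rw [partialSum, dilate_eq_rescale, ← hΦ]
  have hm : AEStronglyMeasurable (Function.uncurry fun y t : Vec n => f t * Φ (y - t))
      (volume.prod volume) :=
    hf.1.comp_snd.mul (Φ.continuous.comp
      (continuous_fst.sub continuous_snd)).aestronglyMeasurable
  exact hm.integral_prod_right'

lemma memLp_partialSum {f : Vec n → ℂ} (hf : MemLp f ∞ volume)
    (φ : SchwartzMap (Vec n) ℂ) {lam : ℝ} (hlam : 1 < lam) (l : ℕ) :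
    MemLp (partialSum lam φ f l) ∞ volume := by
  obtain ⟨B, hB0, hB⟩ := exists_ae_norm_le_of_memLp_top hf
  exact memLp_top_of_bound (aestronglyMeasurable_partialSum hf φ hlam l) _
    (Eventually.of_forall fun y => norm_partialSum_le hB0 hB φ hlam l y)

lemma memLp_block {f : Vec n → ℂ} (hf : MemLp f ∞ volume)
    (φ : SchwartzMap (Vec n) ℂ) {lam : ℝ} (hlam : 1 < lam) (l : ℕ) :
    MemLp (block lam φ f l) ∞ volume := by
  have : block lam φ f l = partialSum lam φ f (l + 1) - partialSum lam φ f l := by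
    funext y; exact block_eq hf φ hlam l y
  rw [this]
  exact (memLp_partialSum hf φ hlam _).sub (memLp_partialSum hf φ hlam _)

/-- The block contains S_{l+1} f, with frequencies up to λ^(l+1); the rescaled φ̂ is 1 on that range
only from level l + 2 on. -/
lemma IsLowPass.block_eq_conv {lam : ℝ} (hlam : 1 < lam) {φ : SchwartzMap (Vec n) ℂ}
    (hφ : IsLowPass lam φ) {f : Vec n → ℂ} (hf : MemLp f ∞ volume) (l : ℕ) (y : Vec n) :
    block lam φ f l y = conv (block lam φ f l) (rescale (lam ^ (l + 2)) φ) y := by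
  have h0 : 0 < lam := by linarith
  have hs : ∀ m, m ≤ l + 1 → partialSum lam φ f m y =
      ∫ t, partialSum lam φ f m t * rescale (lam ^ (l + 2)) φ (y - t) := by
    intro m hm
    rw [← conv_apply, partialSum, dilate_eq_rescale, hφ.conv_conv_rescale hlam hf (by positivity)]
    rw [← pow_succ']
    exact pow_le_pow_right₀ hlam.le (by omega)
  have hi : ∀ m, Integrable fun t =>
      partialSum lam φ f m t * rescale (lam ^ (l + 2)) φ (y - t) := fun m =>
    integrable_mul_schwartz_rescale (memLp_partialSum hf φ hlam m) φ (by positivity) y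
  rw [conv_apply, block_eq hf φ hlam, hs (l + 1) le_rfl, hs l (by omega),
    ← integral_sub (hi _) (hi _)]
  refine integral_congr_ae (Eventually.of_forall fun t => ?_)
  simp only [block_eq hf φ hlam]
  ring

end linearity

/-! ### Taylor approximation of smoothed functions. -/

section taylor

variable {n : ℕ}

/-- The Taylor polynomial of degree `k` of `φ` at `u`, evaluated at the increment `h`. -/
def taylorSum (φ : Vec n → ℂ) (k : ℕ) (u h : Vec n) : ℂ :=
  ∑ m ∈ Finset.range (k + 1), ((m.factorial : ℝ))⁻¹ • iteratedFDeriv ℝ m φ u fun _ => h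

/-- Integral form of the remainder. The decay is available at u + t h and is moved to u at the price
(1 + R)^N, since |t h| ≤ R. -/
lemma norm_sub_taylorSum_le (φ : SchwartzMap (Vec n) ℂ) (k N : ℕ) {R : ℝ} (hR : 0 ≤ R) :
    ∃ C : ℝ, 0 ≤ C ∧ ∀ u h : Vec n, ‖h‖ ≤ R →
      ‖φ (u + h) - taylorSum φ k u h‖ ≤ C * ‖h‖ ^ (k + 1) * ((1 + ‖u‖) ^ N)⁻¹ := by
  set S : ℝ := 2 ^ N * ((Finset.Iic (N, k + 1)).sup
    fun m => SchwartzMap.seminorm ℝ m.1 m.2) φ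
  have hS : ∀ v, (1 + ‖v‖) ^ N * ‖iteratedFDeriv ℝ (k + 1) φ v‖ ≤ S := fun v =>
    SchwartzMap.one_add_le_sup_seminorm_apply (𝕜 := ℝ) (m := (N, k + 1)) le_rfl le_rfl φ v
  have hS0 : 0 ≤ S := by positivity
  refine ⟨S * (1 + R) ^ N, by positivity, fun u h hh => ?_⟩
  have hT := map_add_eq_sum_add_integral_iteratedFDeriv (f := φ) (x := u) (y := h) (n := k)
    fun t _ => φ.contDiffAt ((k + 1 : ℕ) : ℕ∞)
  rw [hT, taylorSum, add_sub_cancel_left, norm_smul]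
  have hfac : ‖((k.factorial : ℝ))⁻¹‖ ≤ 1 := by
    rw [norm_inv, Real.norm_natCast]
    exact inv_le_one_of_one_le₀ (by exact_mod_cast Nat.one_le_iff_ne_zero.2 k.factorial_ne_zero)
  have hint : ‖∫ t in (0 : ℝ)..1, (1 - t) ^ k •
      iteratedFDeriv ℝ (k + 1) φ (u + t • h) fun _ => h‖ ≤
      S * (1 + R) ^ N * ‖h‖ ^ (k + 1) * ((1 + ‖u‖) ^ N)⁻¹ * |1 - 0| := by
    refine intervalIntegral.norm_integral_le_of_norm_le_const fun t ht => ?_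
    rw [Set.uIoc_of_le zero_le_one] at ht
    have h1 : ‖(1 - t) ^ k‖ ≤ 1 := by
      rw [norm_pow]
      refine pow_le_one₀ (norm_nonneg _) ?_
      rw [Real.norm_eq_abs, abs_le]
      constructor <;> linarith [ht.1, ht.2]
    have h2 : ‖iteratedFDeriv ℝ (k + 1) φ (u + t • h) fun _ => h‖ ≤
        ‖iteratedFDeriv ℝ (k + 1) φ (u + t • h)‖ * ‖h‖ ^ (k + 1) := by
      simpa using (iteratedFDeriv ℝ (k + 1) φ (u + t • h)).le_opNorm fun _ => h
    have h3 : ‖iteratedFDeriv ℝ (k + 1) φ (u + t • h)‖ ≤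
        S * (1 + R) ^ N * ((1 + ‖u‖) ^ N)⁻¹ := by
      have h4 : 1 + ‖u‖ ≤ (1 + ‖u + t • h‖) * (1 + R) := by
        have e1 : ‖t • h‖ ≤ R := by
          rw [norm_smul, Real.norm_of_nonneg ht.1.le]
          nlinarith [norm_nonneg h, ht.1, ht.2]
        have e2 : ‖u‖ ≤ ‖u + t • h‖ + ‖t • h‖ := by
          simpa using norm_sub_le (u + t • h) (t • h)
        nlinarith [mul_nonneg (norm_nonneg (u + t • h)) hR]
      rw [← div_eq_mul_inv, le_div_iff₀ (by positivity)]
      calc ‖iteratedFDeriv ℝ (k + 1) φ (u + t • h)‖ * (1 + ‖u‖) ^ N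
          ≤ ‖iteratedFDeriv ℝ (k + 1) φ (u + t • h)‖ *
            ((1 + ‖u + t • h‖) * (1 + R)) ^ N := by gcongr
        _ = ((1 + ‖u + t • h‖) ^ N * ‖iteratedFDeriv ℝ (k + 1) φ (u + t • h)‖) *
            (1 + R) ^ N := by rw [mul_pow]; ring
        _ ≤ S * (1 + R) ^ N := by gcongr; exact hS _
    rw [norm_smul]
    calc _ ≤ 1 * (S * (1 + R) ^ N * ((1 + ‖u‖) ^ N)⁻¹ * ‖h‖ ^ (k + 1)) := by
          gcongr
          exact h2.trans (by gcongr)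
      _ = _ := by ring
  rw [sub_zero, abs_one, mul_one] at hint
  calc _ ≤ 1 * (S * (1 + R) ^ N * ‖h‖ ^ (k + 1) * ((1 + ‖u‖) ^ N)⁻¹) := by gcongr
    _ = _ := one_mul _

/-- Multilinear expansion in the standard basis exhibits the Taylor terms as polynomials in the
coordinates of h. -/
lemma iteratedFDeriv_diag_eq_sum (φ : Vec n → ℂ) (m : ℕ) (u h : Vec n) :
    iteratedFDeriv ℝ m φ u (fun _ => h) = ∑ i : Fin m → Fin n,
      (∏ j, h (i j)) • iteratedFDeriv ℝ m φ u fun j => EuclideanSpace.single (i j) 1 := by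
  have e : h = ∑ i, h i • (EuclideanSpace.single i 1 : Vec n) := by
    ext j
    simp [Finset.sum_apply, Pi.single_apply]
  conv_lhs => rw [e]
  rw [ContinuousMultilinearMap.map_sum]
  exact Finset.sum_congr rfl fun i _ => ContinuousMultilinearMap.map_smul_univ _ _ _

/-- Integrating a Taylor coefficient of `φ` against `g`. -/
def taylorCoeff (φ g : Vec n → ℂ) (a : ℝ) (x : Vec n) (m : ℕ) (i : Fin m → Fin n) : ℂ :=
  conv g (rescale a fun u => iteratedFDeriv ℝ m φ u fun j => EuclideanSpace.single (i j) 1) x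

/-- The averaged Taylor polynomial of `g * φ_a` at `x`. -/
def taylorPoly (φ g : Vec n → ℂ) (a : ℝ) (x : Vec n) (k : ℕ) : MvPolynomial (Fin n) ℂ :=
  ∑ m ∈ Finset.range (k + 1), ∑ i : Fin m → Fin n,
    MvPolynomial.C (((m.factorial : ℝ)⁻¹ : ℂ) * taylorCoeff φ g a x m i) *
      ∏ j, (MvPolynomial.C (a : ℂ) * (MvPolynomial.X (i j) - MvPolynomial.C (x (i j) : ℂ)))

lemma totalDegree_taylorPoly_le (φ g : Vec n → ℂ) (a : ℝ) (x : Vec n) (k : ℕ) :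
    (taylorPoly φ g a x k).totalDegree ≤ k := by
  refine MvPolynomial.totalDegree_finsetSum_le fun m hm => ?_
  refine MvPolynomial.totalDegree_finsetSum_le fun i _ => ?_
  refine (MvPolynomial.totalDegree_mul _ _).trans ?_
  rw [MvPolynomial.totalDegree_C, zero_add]
  refine (MvPolynomial.totalDegree_finsetProd _ _).trans ?_
  refine (Finset.sum_le_card_nsmul _ _ 1 fun j _ => ?_).trans ?_
  · refine (MvPolynomial.totalDegree_mul _ _).trans ?_
    rw [MvPolynomial.totalDegree_C, zero_add]
    refine (MvPolynomial.totalDegree_sub _ _).trans ?_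
    simp
  · have := Finset.mem_range.1 hm
    simp
    omega

lemma integrable_inv_one_add_norm_pow :
    Integrable fun u : Vec n => ((1 + ‖u‖) ^ (n + 1))⁻¹ := by
  have := integrable_one_add_norm (E := Vec n) (μ := volume) (r := (n + 1 : ℕ)) (by simp)
  refine this.congr (Eventually.of_forall fun u => ?_)
  simp only
  rw [Real.rpow_neg (by positivity), Real.rpow_natCast]

lemma integrable_iteratedFDeriv_weight (φ : SchwartzMap (Vec n) ℂ) (m : ℕ) (K : ℕ)
    (i : Fin m → Fin n) :
    Integrable fun u => ‖iteratedFDeriv ℝ m φ u fun j => EuclideanSpace.single (i j) 1‖ *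
      (1 + ‖u‖) ^ K := by
  have hc : Continuous fun u => iteratedFDeriv ℝ m φ u :=
    (φ.smooth ⊤).continuous_iteratedFDeriv (mod_cast le_top)
  have h : Integrable fun u => ‖iteratedFDeriv ℝ m φ u‖ * (1 + ‖u‖) ^ K := by
    have h : ∀ u : Vec n, ‖iteratedFDeriv ℝ m φ u‖ * (1 + ‖u‖) ^ K =
        ∑ p ∈ Finset.range (K + 1), (K.choose p : ℝ) *
          (‖u‖ ^ p * ‖iteratedFDeriv ℝ m φ u‖) := by
      intro u
      rw [add_comm, add_pow, Finset.mul_sum]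
      refine Finset.sum_congr rfl fun m _ => ?_
      simp; ring
    simp_rw [h]
    exact integrable_finsetSum _ fun p _ =>
      (φ.integrable_pow_mul_iteratedFDeriv volume p m).const_mul _
  refine h.mono' (Continuous.aestronglyMeasurable ?_) (Eventually.of_forall fun u => ?_)
  · have : Continuous fun u => iteratedFDeriv ℝ m φ u fun j => EuclideanSpace.single (i j) 1 :=
      hc.eval_const _
    fun_prop
  · rw [norm_mul, norm_norm, Real.norm_of_nonneg (by positivity : 0 ≤ (1 + ‖u‖) ^ K)]
    gcongr
    simpa using (iteratedFDeriv ℝ m φ u).le_opNorm fun j => EuclideanSpace.single (i j) (1 : ℝ)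

lemma continuous_iteratedFDeriv_apply (φ : SchwartzMap (Vec n) ℂ) (m : ℕ) (v : Fin m → Vec n) :
    Continuous fun u => iteratedFDeriv ℝ m φ u v :=
  ((φ.smooth ⊤).continuous_iteratedFDeriv (mod_cast le_top)).eval_const _

/-- The increment a(y - x) does not involve the integration variable, so integrating leaves a
polynomial in y. -/
lemma polyFun_taylorPoly {φ : SchwartzMap (Vec n) ℂ} {g : Vec n → ℂ}
    (hg : AEStronglyMeasurable g) {a A : ℝ} (ha : 0 < a) (hA : 0 ≤ A) {K : ℕ} {x : Vec n}
    (hgA : ∀ᵐ t, ‖g t‖ ≤ A * (1 + a * ‖t - x‖) ^ K) (k : ℕ) (y : Vec n) :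
    Integrable (fun t => g t * rescale a (fun u => taylorSum φ k u (a • (y - x))) (x - t)) ∧
    conv g (rescale a fun u => taylorSum φ k u (a • (y - x))) x =
      polyFun (taylorPoly φ g a x k) y := by
  have hi : ∀ m (i : Fin m → Fin n), Integrable fun t => g t * rescale a
      (fun u => iteratedFDeriv ℝ m φ u fun j => EuclideanSpace.single (i j) 1) (x - t) :=
    fun m i => integrable_mul_rescale hg (continuous_iteratedFDeriv_apply φ m _)
      (integrable_iteratedFDeriv_weight φ m K i) ha ha.le le_rfl hA hgA x
  have e : (fun t => g t * rescale a (fun u => taylorSum φ k u (a • (y - x))) (x - t)) =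
      fun t => ∑ m ∈ Finset.range (k + 1), ∑ i : Fin m → Fin n,
        (((m.factorial : ℝ)⁻¹ : ℂ) * ∏ j, ((a * (y (i j) - x (i j)) : ℝ) : ℂ)) *
        (g t * rescale a
      (fun u => iteratedFDeriv ℝ m φ u fun j => EuclideanSpace.single (i j) 1) (x - t)) := by
    funext t
    simp only [rescale, taylorSum, iteratedFDeriv_diag_eq_sum, Finset.mul_sum, Finset.smul_sum]
    refine Finset.sum_congr rfl fun m _ => Finset.sum_congr rfl fun i _ => ?_
    simp only [Complex.real_smul, PiLp.smul_apply, PiLp.sub_apply, smul_eq_mul]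
    push_cast
    ring
  rw [conv_apply, e]
  refine ⟨integrable_finsetSum _ fun m _ => integrable_finsetSum _ fun i _ =>
    (hi m i).const_mul _, ?_⟩
  rw [integral_finsetSum _ fun m _ => integrable_finsetSum _ fun i _ => (hi m i).const_mul _]
  simp only [polyFun, taylorPoly, map_sum]
  refine Finset.sum_congr rfl fun m _ => ?_
  rw [integral_finsetSum _ fun i _ => (hi m i).const_mul _]
  refine Finset.sum_congr rfl fun i _ => ?_
  rw [integral_const_mul, ← conv_apply]
  simp only [taylorCoeff, map_mul, map_prod, MvPolynomial.eval_C, map_sub, MvPolynomial.eval_X]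
  push_cast
  ring

/-- Since a(y - t) = a(x - t) + a(y - x), the kernel is expanded at a(x - t) and the remainder
integrated against g. The constant is uniform in g, a, A and x, as needed for summing over scales.
-/
lemma exists_poly_near_conv_rescale (φ : SchwartzMap (Vec n) ℂ) (k K : ℕ) {R : ℝ} (hR : 0 ≤ R) :
    ∃ C : ℝ, 0 ≤ C ∧ ∀ (g : Vec n → ℂ) (a A : ℝ) (x : Vec n), AEStronglyMeasurable g → 0 < a →
      0 ≤ A → (∀ᵐ t, ‖g t‖ ≤ A * (1 + a * ‖t - x‖) ^ K) →
      ∃ P : MvPolynomial (Fin n) ℂ, P.totalDegree ≤ k ∧ ∀ y, a * ‖y - x‖ ≤ R →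
        ‖conv g (rescale a φ) y - polyFun P y‖ ≤ C * A * (a * ‖y - x‖) ^ (k + 1) := by
  -- Of the decay exponent, K compensates the growth of g and n + 1 makes the rest integrable.
  obtain ⟨C, hC0, hC⟩ := norm_sub_taylorSum_le φ k (K + (n + 1)) hR
  set I : ℝ := ∫ u : Vec n, ((1 + ‖u‖) ^ (n + 1))⁻¹
  have hI : 0 ≤ I := integral_nonneg fun u => by positivity
  refine ⟨C * I, by positivity, fun g a A x hg ha hA hgA => ?_⟩
  refine ⟨taylorPoly φ g a x k, totalDegree_taylorPoly_le _ _ _ _ _, fun y hy => ?_⟩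
  obtain ⟨hi, he⟩ := polyFun_taylorPoly (φ := φ) hg ha hA hgA k y
  set h : Vec n := a • (y - x)
  have hh : ‖h‖ = a * ‖y - x‖ := by simp [h, norm_smul, abs_of_pos ha]
  have hφi : Integrable fun t => g t * rescale a φ (y - t) :=
    integrable_mul_rescale hg φ.continuous (integrable_schwartz_weight φ K) ha ha.le le_rfl hA
      hgA y
  have hdiff : conv g (rescale a φ) y - polyFun (taylorPoly φ g a x k) y =
      conv g (rescale a fun u => φ (u + h) - taylorSum φ k u h) x := by
    rw [← he, conv_apply, conv_apply, conv_apply, ← integral_sub hφi hi]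
    refine integral_congr_ae (Eventually.of_forall fun t => ?_)
    have : a • (y - t) = a • (x - t) + h := by
      simp only [h, ← smul_add]
      congr 1
      abel
    simp only [rescale, this]
    ring
  have hbd : ∀ u : Vec n, ‖φ (u + h) - taylorSum φ k u h‖ * (1 + ‖u‖) ^ K ≤
      C * ‖h‖ ^ (k + 1) * ((1 + ‖u‖) ^ (n + 1))⁻¹ := by
    intro u
    calc _ ≤ C * ‖h‖ ^ (k + 1) * ((1 + ‖u‖) ^ (K + (n + 1)))⁻¹ * (1 + ‖u‖) ^ K := by
          gcongr
          exact hC u h (hh.trans_le hy)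
      _ = _ := by
          rw [pow_add (1 + ‖u‖) K]
          field_simp
  have hcont : Continuous fun u => φ (u + h) - taylorSum φ k u h := by
    unfold taylorSum
    refine (φ.continuous.comp (continuous_id.add continuous_const)).sub ?_
    exact continuous_finsetSum _ fun m _ => (continuous_iteratedFDeriv_apply φ m fun _ => h).const_smul
      ((m.factorial : ℝ)⁻¹)
  have hint : Integrable fun u => ‖φ (u + h) - taylorSum φ k u h‖ * (1 + ‖u‖) ^ K := by
    refine (integrable_inv_one_add_norm_pow.const_mul (C * ‖h‖ ^ (k + 1))).mono'
      (Continuous.aestronglyMeasurable (by fun_prop)) (Eventually.of_forall fun u => ?_)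
    rw [Real.norm_of_nonneg (by positivity)]
    exact hbd u
  rw [hdiff]
  refine (norm_conv_rescale_le hint ha ha.le le_rfl hA hgA x).trans ?_
  rw [sub_self, norm_zero, mul_zero, add_zero, one_pow, mul_one]
  calc _ ≤ (∫ u : Vec n, C * ‖h‖ ^ (k + 1) * ((1 + ‖u‖) ^ (n + 1))⁻¹) * A := by
        gcongr
        exact integrable_inv_one_add_norm_pow.const_mul _
        exact fun u => hbd u
    _ = _ := by rw [integral_const_mul, hh]; ring

end taylor

/-! ### Growth of polynomials bounded on a ball. -/

section polynomials

open Polynomial in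
/-- A polynomial bounded at suitable nodes of the unit interval grows at a controlled rate. -/
lemma exists_polynomial_growth (k : ℕ) : ∃ C : ℝ, 0 ≤ C ∧ ∀ (p : ℂ[X]) (ε : ℝ),
    p.natDegree ≤ k → (∀ t : ℝ, 0 ≤ t → t < 1 → ‖p.eval (t : ℂ)‖ ≤ ε) →
    ∀ t : ℝ, 0 ≤ t → ‖p.eval (t : ℂ)‖ ≤ C * ε * (1 + t) ^ k := by
  -- The k + 1 nodes i/(k+1) lie in [0, 1), and Lagrange interpolation there recovers p; the
  -- constant collects the coefficients of the basis polynomials.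
  set v : ℕ → ℂ := fun i => (((i : ℝ) / (k + 1) : ℝ) : ℂ)
  set s := Finset.range (k + 1)
  have hv : Set.InjOn v s := by
    intro i _ j _ hij
    have h1 : (i : ℝ) / (k + 1) = (j : ℝ) / (k + 1) := Complex.ofReal_injective hij
    have h2 : ((k : ℝ) + 1) ≠ 0 := by positivity
    exact_mod_cast (div_left_inj' h2).1 h1
  have hgrow : ∀ (b : ℂ[X]), b.natDegree ≤ k → ∀ t : ℝ, 0 ≤ t →
      ‖b.eval (t : ℂ)‖ ≤ (∑ m ∈ Finset.range (k + 1), ‖b.coeff m‖) * (1 + t) ^ k := by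
    intro b hb t ht
    rw [eval_eq_sum_range' (Nat.lt_succ_of_le hb), Finset.sum_mul]
    refine (norm_sum_le _ _).trans (Finset.sum_le_sum fun m hm => ?_)
    rw [norm_mul, norm_pow, Complex.norm_real, Real.norm_of_nonneg ht]
    gcongr
    calc t ^ m ≤ (1 + t) ^ m := by gcongr; linarith
      _ ≤ (1 + t) ^ k := pow_le_pow_right₀ (by linarith)
          (Nat.lt_succ_iff.1 (Finset.mem_range.1 hm))
  refine ⟨∑ i ∈ s, ∑ m ∈ Finset.range (k + 1), ‖(Lagrange.basis s v i).coeff m‖,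
    by positivity, fun p ε hp hε t ht => ?_⟩
  have hdeg : p.degree < s.card := by
    rw [Finset.card_range]
    exact (degree_le_of_natDegree_le hp).trans_lt (by exact_mod_cast Nat.lt_succ_self k)
  rw [Lagrange.eq_interpolate hv hdeg, Lagrange.interpolate_apply, eval_finsetSum, Finset.sum_mul,
    Finset.sum_mul]
  refine (norm_sum_le _ _).trans (Finset.sum_le_sum fun i hi => ?_)
  rw [eval_mul, eval_C, norm_mul]
  have hi' : (i : ℝ) < k + 1 := by exact_mod_cast Finset.mem_range.1 hi
  have h1 : ‖p.eval (v i)‖ ≤ ε := hε _ (by positivity) (by rwa [div_lt_one (by positivity)])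
  have h2 := hgrow (Lagrange.basis s v i)
    (by rw [Lagrange.natDegree_basis hv hi, Finset.card_range]; omega) t ht
  calc _ ≤ ε * ((∑ m ∈ Finset.range (k + 1), ‖(Lagrange.basis s v i).coeff m‖) *
        (1 + t) ^ k) := by
        gcongr
        exact (norm_nonneg _).trans h1
    _ = _ := by ring

variable {n : ℕ}

lemma continuous_polyFun (P : MvPolynomial (Fin n) ℂ) : Continuous (polyFun P) := by
  unfold polyFun
  refine (MvPolynomial.continuous_eval P).comp ?_
  fun_prop

lemma polyFun_sub (P Q : MvPolynomial (Fin n) ℂ) (y : Vec n) :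
    polyFun (P - Q) y = polyFun P y - polyFun Q y := by
  simp [polyFun]

lemma polyFun_add (P Q : MvPolynomial (Fin n) ℂ) (y : Vec n) :
    polyFun (P + Q) y = polyFun P y + polyFun Q y := by
  simp [polyFun]

lemma polyFun_sum {ι : Type*} (s : Finset ι) (P : ι → MvPolynomial (Fin n) ℂ) (y : Vec n) :
    polyFun (∑ i ∈ s, P i) y = ∑ i ∈ s, polyFun (P i) y := by
  simp [polyFun]

lemma exists_line_polynomial (P : MvPolynomial (Fin n) ℂ) (x v : Vec n) :
    ∃ p : Polynomial ℂ, p.natDegree ≤ P.totalDegree ∧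
      ∀ t : ℝ, p.eval (t : ℂ) = polyFun P (x + t • v) := by
  refine ⟨MvPolynomial.aeval (fun i => Polynomial.C (x i : ℂ) +
    Polynomial.C (v i : ℂ) * Polynomial.X) P, ?_, fun t => ?_⟩
  · refine (MvPolynomial.aeval_natDegree_le P le_rfl _ (n := 1) fun i => ?_).trans_eq (mul_one _)
    rw [add_comm]
    exact Polynomial.natDegree_linear_le
  · simp only [polyFun, MvPolynomial.aeval_def]
    rw [← Polynomial.coe_evalRingHom, ← MvPolynomial.coe_eval₂Hom, ← RingHom.comp_apply]
    congr 1
    apply MvPolynomial.ringHom_ext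
    · intro
      simp
    · intro
      simp
      ring

/-- Restriction to the ray from x through y, with parameter 1 at distance ρ, reduces to one
variable. The point y = x has no direction and is treated separately. -/
lemma exists_polyFun_growth (n k : ℕ) : ∃ C : ℝ, 0 ≤ C ∧
    ∀ (P : MvPolynomial (Fin n) ℂ) (ε ρ : ℝ) (x : Vec n), P.totalDegree ≤ k → 0 < ρ →
    (∀ y ∈ Metric.ball x ρ, ‖polyFun P y‖ ≤ ε) →
    ∀ y, ‖polyFun P y‖ ≤ C * ε * (1 + ‖y - x‖ / ρ) ^ k := by
  obtain ⟨C, hC0, hC⟩ := exists_polynomial_growth k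
  refine ⟨C, hC0, fun P ε ρ x hP hρ hε y => ?_⟩
  rcases eq_or_ne y x with rfl | hyx
  · obtain ⟨p, hp, hpe⟩ := exists_line_polynomial P y 0
    have := hC p ε (hp.trans hP) (fun t _ _ => by
      rw [hpe]; simpa using hε y (Metric.mem_ball_self hρ)) 0 le_rfl
    rw [hpe] at this
    simpa using this
  · have hd : 0 < ‖y - x‖ := norm_pos_iff.2 (sub_ne_zero.2 hyx)
    obtain ⟨p, hp, hpe⟩ := exists_line_polynomial P x ((ρ / ‖y - x‖) • (y - x))
    have hnorm : ‖(ρ / ‖y - x‖) • (y - x)‖ = ρ := by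
      rw [norm_smul, Real.norm_of_nonneg (by positivity)]
      field_simp
    have := hC p ε (hp.trans hP) (fun t ht0 ht1 => by
      rw [hpe]
      apply hε
      rw [mem_ball_iff_norm, add_sub_cancel_left, norm_smul, hnorm, Real.norm_of_nonneg ht0]
      nlinarith) (‖y - x‖ / ρ) (by positivity)
    rw [hpe, smul_smul] at this
    have e : ‖y - x‖ / ρ * (ρ / ‖y - x‖) = 1 := by field_simp
    rwa [e, one_smul, add_sub_cancel] at this

/-- Nonempty open sets have positive measure. This turns almost-everywhere estimates into the
pointwise bounds required by `exists_polyFun_growth`. -/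
lemma norm_le_of_ae_le_on_ball {F : Vec n → ℂ} (hF : Continuous F) {ε ρ : ℝ} {x : Vec n}
    (h : ∀ᵐ y, y ∈ Metric.ball x ρ → ‖F y‖ ≤ ε) : ∀ y ∈ Metric.ball x ρ, ‖F y‖ ≤ ε := by
  intro y hy
  by_contra hlt
  push Not at hlt
  have hopen : IsOpen (Metric.ball x ρ ∩ {z | ε < ‖F z‖}) :=
    Metric.isOpen_ball.inter (isOpen_lt continuous_const hF.norm)
  have hpos := hopen.measure_pos volume ⟨y, hy, hlt⟩
  refine hpos.ne' (measure_mono_null ?_ (ae_iff.1 h))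
  intro z hz
  simpa using hz

end polynomials

/-! ### Cells, balls and a quantitative form of C^s(x). -/

section cells

variable {n : ℕ} {lam : ℝ} {Q₀ : Set (Vec n)}

lemma isClosed_cell (hQ₀ : IsCompact Q₀) (l : ℕ) (x : Vec n) : IsClosed (cell lam Q₀ l x) :=
  hQ₀.isClosed.preimage (f := fun y => lam ^ l • (y - x)) (by fun_prop)

lemma exists_cell_subset_closedBall (hlam : 1 < lam) (hQ₀ : IsCompact Q₀) (x : Vec n) :
    ∃ R : ℝ, 0 ≤ R ∧ ∀ l, ∀ y ∈ cell lam Q₀ l x, lam ^ l * ‖y - x‖ ≤ R := by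
  have h0 : 0 < lam := by linarith
  obtain ⟨R, hR⟩ := hQ₀.isBounded.exists_norm_le
  refine ⟨max R 0, le_max_right _ _, fun l y hy => (le_trans ?_ (hR _ hy)).trans (le_max_left _ _)⟩
  rw [norm_smul, Real.norm_of_nonneg (by positivity)]

lemma exists_ball_subset_cell (hlam : 1 < lam) (hQ₀' : 0 ∈ interior Q₀) (x : Vec n) :
    ∃ r : ℝ, 0 < r ∧ ∀ l, Metric.ball x (r / lam ^ l) ⊆ cell lam Q₀ l x := by
  have h0 : 0 < lam := by linarith
  obtain ⟨r, hr, hrQ⟩ := Metric.mem_nhds_iff.1 (mem_interior_iff_mem_nhds.1 hQ₀')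
  refine ⟨r, hr, fun l y hy => hrQ ?_⟩
  have hp : 0 < lam ^ l := by positivity
  rw [mem_ball_iff_norm, lt_div_iff₀ hp] at hy
  rw [mem_ball_zero_iff, norm_smul, Real.norm_of_nonneg hp.le]
  linarith

/-- Normalization does not change null sets: a bounded cell has finite volume, so the factor is
nonzero. -/
lemma ae_cond_cell_iff (hlam : 1 < lam) (hQ₀ : IsCompact Q₀) (l : ℕ) (x : Vec n)
    (p : Vec n → Prop) : (∀ᵐ y ∂(ProbabilityTheory.cond volume (cell lam Q₀ l x)), p y) ↔
      ∀ᵐ y, y ∈ cell lam Q₀ l x → p y := by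
  have h0 : 0 < lam := by linarith
  rw [ProbabilityTheory.cond, Measure.ae_ennreal_smul_measure_iff,
    ae_restrict_iff' (isClosed_cell hQ₀ l x).measurableSet]
  obtain ⟨R, hR0, hR⟩ := exists_cell_subset_closedBall hlam hQ₀ x
  have hsub : cell lam Q₀ l x ⊆ Metric.closedBall x (R / lam ^ l) := fun y hy => by
    rw [mem_closedBall_iff_norm, le_div_iff₀ (by positivity)]
    linarith [hR l y hy]
  exact ENNReal.inv_ne_zero.2 ((measure_mono hsub).trans_lt measure_closedBall_lt_top).ne

lemma memC_iff (hlam : 1 < lam) (hQ₀ : IsCompact Q₀) {k : ℕ} {s : ℝ} {f : Vec n → ℂ}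
    {x : Vec n} : MemC lam Q₀ k s f x ↔ ∃ C : ℝ, 0 ≤ C ∧ ∀ l : ℕ,
      ∃ P : MvPolynomial (Fin n) ℂ, P.totalDegree ≤ k ∧
        ∀ᵐ y, y ∈ cell lam Q₀ l x → ‖f y - polyFun P y‖ ≤ C * (lam ^ (-s)) ^ l := by
  have h0 : 0 < lam := by linarith
  have hq : ∀ l : ℕ, lam ^ ((l : ℝ) * s) * (lam ^ (-s)) ^ l = 1 := by
    intro l
    rw [← Real.rpow_natCast, ← Real.rpow_mul h0.le, ← Real.rpow_add h0]
    simp [mul_comm]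
  have hpos : ∀ l : ℕ, 0 < lam ^ ((l : ℝ) * s) := fun l => Real.rpow_pos_of_pos h0 _
  have hqpos : ∀ l : ℕ, 0 < (lam ^ (-s)) ^ l := fun l => pow_pos (Real.rpow_pos_of_pos h0 _) _
  rw [MemC, MemT, eLpNorm_exponent_top, eLpNormEssSup_count]
  simp only [enorm_eq_self]
  constructor
  · intro h
    set T := ⨆ l : ℕ, ENNReal.ofReal (lam ^ ((l : ℝ) * s)) * osc lam Q₀ k ∞ f x l
    -- The added 1 makes the bound on the infimum strict, so some polynomial attains it.
    refine ⟨T.toReal + 1, by positivity, fun l => ?_⟩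
    have hl : ENNReal.ofReal (lam ^ ((l : ℝ) * s)) * osc lam Q₀ k ∞ f x l ≤ T :=
      le_iSup (fun l : ℕ => ENNReal.ofReal (lam ^ ((l : ℝ) * s)) * osc lam Q₀ k ∞ f x l) l
    have hosc : osc lam Q₀ k ∞ f x l < ENNReal.ofReal ((T.toReal + 1) * (lam ^ (-s)) ^ l) := by
      by_contra hcon
      push Not at hcon
      have h1 : ENNReal.ofReal (T.toReal + 1) ≤ T := by
        calc ENNReal.ofReal (T.toReal + 1)
            = ENNReal.ofReal (lam ^ ((l : ℝ) * s)) *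
              ENNReal.ofReal ((T.toReal + 1) * (lam ^ (-s)) ^ l) := by
                rw [← ENNReal.ofReal_mul (hpos l).le]
                congr 1
                linear_combination -(T.toReal + 1) * hq l
          _ ≤ _ := by gcongr
          _ ≤ T := hl
      have h2 := ENNReal.toReal_mono h.ne h1
      rw [ENNReal.toReal_ofReal (by positivity)] at h2
      linarith
    rw [osc, iInf_lt_iff] at hosc
    obtain ⟨P, hP⟩ := hosc
    rw [iInf_lt_iff] at hP
    obtain ⟨hdeg, hP⟩ := hP
    refine ⟨P, hdeg, ?_⟩
    rw [← ae_cond_cell_iff hlam hQ₀]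
    rw [eLpNorm_exponent_top] at hP
    filter_upwards [ae_le_eLpNormEssSup (f := fun y => f y - polyFun P y)
      (μ := ProbabilityTheory.cond volume (cell lam Q₀ l x))] with y hy
    have := hy.trans hP.le
    rwa [← ofReal_norm, ENNReal.ofReal_le_ofReal_iff (by have := hqpos l; positivity)] at this
  · rintro ⟨C, hC0, hC⟩
    refine lt_of_le_of_lt (iSup_le fun l => ?_) (ENNReal.ofReal_lt_top (r := C))
    obtain ⟨P, hdeg, hP⟩ := hC l
    have h1 : osc lam Q₀ k ∞ f x l ≤ ENNReal.ofReal (C * (lam ^ (-s)) ^ l) := by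
      refine (iInf₂_le P hdeg).trans ?_
      rw [eLpNorm_exponent_top]
      exact eLpNormEssSup_le_of_ae_bound ((ae_cond_cell_iff hlam hQ₀ l x _).2 hP)
    calc _ ≤ ENNReal.ofReal (lam ^ ((l : ℝ) * s)) * ENNReal.ofReal (C * (lam ^ (-s)) ^ l) := by
          gcongr
      _ = ENNReal.ofReal C := by
          rw [← ENNReal.ofReal_mul (hpos l).le]
          congr 1
          linear_combination C * hq l

end cells

/-! ### From pointwise regularity to Littlewood–Paley bounds. -/

section forward

variable {n : ℕ} {lam s : ℝ} {k : ℕ}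

lemma rpow_neg_pos (hlam : 1 < lam) (s : ℝ) : 0 < lam ^ (-s) :=
  Real.rpow_pos_of_pos (by linarith) _

lemma rpow_neg_le_one (hlam : 1 < lam) (hs : 0 < s) : lam ^ (-s) ≤ 1 :=
  Real.rpow_le_one_of_one_le_of_nonpos hlam.le (by linarith)

lemma inv_pow_lt_rpow_neg (hlam : 1 < lam) (hk : s < k + 1) :
    (lam ^ (k + 1))⁻¹ < lam ^ (-s) := by
  rw [← Real.rpow_natCast, ← Real.rpow_neg (by linarith)]
  apply Real.rpow_lt_rpow_of_exponent_lt hlam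
  push_cast
  linarith

/-- Local polynomial approximations at all scales are global approximations with controlled
growth. -/
lemma exists_global_bound_sub_polyFun (hlam : 1 < lam) (hs : 0 < s) (hk : s < k + 1)
    {f : Vec n → ℂ} (hf : MemLp f ∞ volume) {x : Vec n} {A r : ℝ} (hA : 0 ≤ A) (hr : 0 < r)
    {P : ℕ → MvPolynomial (Fin n) ℂ} (hdeg : ∀ j, (P j).totalDegree ≤ k)
    (hP : ∀ j, ∀ᵐ y, y ∈ Metric.ball x (r / lam ^ j) →
      ‖f y - polyFun (P j) y‖ ≤ A * (lam ^ (-s)) ^ j) :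
    ∃ C : ℝ, 0 ≤ C ∧ ∀ j, ∀ᵐ y, ‖f y - polyFun (P j) y‖ ≤
      C * (lam ^ (-s)) ^ j * (1 + lam ^ j * ‖y - x‖) ^ (k + 1) := by
  have h0 : 0 < lam := by linarith
  set q := lam ^ (-s)
  set θ := (lam ^ (k + 1))⁻¹
  have hq0 : 0 < q := rpow_neg_pos hlam s
  have hq1 : q ≤ 1 := rpow_neg_le_one hlam hs
  have hθ0 : 0 < θ := by positivity
  have hθq : 0 < q - θ := sub_pos.2 (inv_pow_lt_rpow_neg hlam hk)
  obtain ⟨B, hB0, hB⟩ := exists_ae_norm_le_of_memLp_top hf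
  obtain ⟨G, hG0, hG⟩ := exists_polyFun_growth n k
  set D₀ := (B + G * (A + B)) * (2 / r) ^ (k + 1)
  set D := (A + G * (2 * A)) * (2 / r) ^ (k + 1)
  have hD₀ : 0 ≤ D₀ := by positivity
  have hD : 0 ≤ D := by positivity
  -- D₀ covers the base case, and D/(q - θ) solves D + θA' = qA', which closes the induction.
  set A' := D₀ + D / (q - θ)
  have hA' : 0 ≤ A' := by positivity
  have hstep : D + θ * A' ≤ q * A' := by
    have : D = (q - θ) * (D / (q - θ)) := by field_simp
    nlinarith [mul_nonneg hθq.le hD₀]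
  -- Outside the ball d/ρ ≥ 1, so constants and k-th powers are absorbed into the (k+1)-st power.
  have far : ∀ ρ d : ℝ, 0 < ρ → ρ ≤ d → 1 ≤ (2 * (d / ρ)) ^ (k + 1) ∧
      (1 + d / ρ) ^ k ≤ (2 * (d / ρ)) ^ (k + 1) := by
    intro ρ d hρ hd
    have h1 : 1 ≤ d / ρ := (one_le_div hρ).2 hd
    refine ⟨one_le_pow₀ (by linarith), ?_⟩
    calc (1 + d / ρ) ^ k ≤ (2 * (d / ρ)) ^ k := by gcongr; linarith
      _ ≤ _ := pow_le_pow_right₀ (by linarith) (Nat.le_succ k)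
  have main : ∀ j, ∀ᵐ y, ‖f y - polyFun (P j) y‖ ≤
      q ^ j * (A + A' * (lam ^ j * ‖y - x‖) ^ (k + 1)) := by
    intro j
    induction j with
    | zero =>
      have hP0 : ∀ y ∈ Metric.ball x r, ‖polyFun (P 0) y‖ ≤ A + B := by
        refine norm_le_of_ae_le_on_ball (continuous_polyFun _) ?_
        filter_upwards [hP 0, hB] with y h1 h2 hy
        have h3 := h1 (by simpa using hy)
        have h4 := norm_sub_le (f y) (f y - polyFun (P 0) y)
        rw [sub_sub_cancel] at h4
        simp only [pow_zero, mul_one] at h3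
        linarith
      have hg := hG (P 0) (A + B) r x (hdeg 0) hr hP0
      filter_upwards [hP 0, hB] with y h1 h2
      simp only [pow_zero, one_mul]
      by_cases hy : y ∈ Metric.ball x r
      · have h3 := h1 (by simpa using hy)
        simp only [pow_zero, mul_one] at h3
        have : 0 ≤ A' * ‖y - x‖ ^ (k + 1) := by positivity
        linarith
      · rw [mem_ball_iff_norm, not_lt] at hy
        obtain ⟨e1, e2⟩ := far r _ hr hy
        calc ‖f y - polyFun (P 0) y‖ ≤ ‖f y‖ + ‖polyFun (P 0) y‖ := norm_sub_le _ _
          _ ≤ B * 1 + G * (A + B) * (1 + ‖y - x‖ / r) ^ k := by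
            rw [mul_one]; exact add_le_add h2 (hg y)
          _ ≤ B * (2 * (‖y - x‖ / r)) ^ (k + 1) +
              G * (A + B) * (2 * (‖y - x‖ / r)) ^ (k + 1) := by gcongr
          _ = D₀ * ‖y - x‖ ^ (k + 1) := by
            rw [show 2 * (‖y - x‖ / r) = 2 / r * ‖y - x‖ by ring, mul_pow]; ring
          _ ≤ A + A' * ‖y - x‖ ^ (k + 1) := by
            have h3 : D₀ ≤ A' := le_add_of_nonneg_right (by positivity)
            have h4 : D₀ * ‖y - x‖ ^ (k + 1) ≤ A' * ‖y - x‖ ^ (k + 1) := by gcongr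
            linarith
    | succ j ih =>
      have hρ : 0 < r / lam ^ (j + 1) := by positivity
      -- Both approximations are valid on the smaller ball; the growth lemma then controls their
      -- difference everywhere.
      have hPd : ∀ y ∈ Metric.ball x (r / lam ^ (j + 1)),
          ‖polyFun (P j - P (j + 1)) y‖ ≤ 2 * A * q ^ j := by
        refine norm_le_of_ae_le_on_ball (continuous_polyFun _) ?_
        filter_upwards [hP j, hP (j + 1)] with y h1 h2 hy
        have h1' := h1 (Metric.ball_subset_ball
          (div_le_div_of_nonneg_left hr.le (by positivity)
            (pow_le_pow_right₀ hlam.le (Nat.le_succ j))) hy)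
        have h2' := h2 hy
        have h3 : A * q ^ (j + 1) ≤ A * q ^ j := by
          gcongr ?_ * ?_
          exact pow_le_pow_of_le_one hq0.le hq1 (Nat.le_succ j)
        rw [polyFun_sub]
        have h4 := norm_sub_le (f y - polyFun (P (j + 1)) y) (f y - polyFun (P j) y)
        rw [sub_sub_sub_cancel_left] at h4
        linarith
      have hg := hG (P j - P (j + 1)) _ _ x
        ((MvPolynomial.totalDegree_sub _ _).trans (max_le (hdeg _) (hdeg _))) hρ hPd
      filter_upwards [hP (j + 1), ih] with y h1 h2
      by_cases hy : y ∈ Metric.ball x (r / lam ^ (j + 1))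
      · refine (h1 hy).trans ?_
        rw [mul_comm A]
        gcongr
        have : 0 ≤ A' * (lam ^ (j + 1) * ‖y - x‖) ^ (k + 1) := by positivity
        linarith
      · rw [mem_ball_iff_norm, not_lt] at hy
        obtain ⟨e1, e2⟩ := far _ _ hρ hy
        set u := lam ^ (j + 1) * ‖y - x‖
        have hu : 2 * (‖y - x‖ / (r / lam ^ (j + 1))) = 2 / r * u := by
          simp only [u]; field_simp
        rw [hu] at e1 e2
        -- Rewriting the weight of level j at level j + 1 gains the factor θ.
        have hu' : (lam ^ j * ‖y - x‖) ^ (k + 1) = θ * u ^ (k + 1) := by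
          simp only [u, θ, pow_succ lam j, mul_pow]
          field_simp
        have hg' := hg y
        rw [polyFun_sub] at hg'
        calc ‖f y - polyFun (P (j + 1)) y‖
            = ‖(f y - polyFun (P j) y) + (polyFun (P j) y - polyFun (P (j + 1)) y)‖ := by
              congr 1; ring
          _ ≤ q ^ j * (A * 1 + A' * (θ * u ^ (k + 1))) +
              G * (2 * A * q ^ j) * (1 + ‖y - x‖ / (r / lam ^ (j + 1))) ^ k := by
              rw [mul_one, ← hu']
              exact (norm_add_le _ _).trans (add_le_add h2 hg')
          _ ≤ q ^ j * (A * (2 / r * u) ^ (k + 1) + A' * (θ * u ^ (k + 1))) +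
              G * (2 * A * q ^ j) * (2 / r * u) ^ (k + 1) := by gcongr
          _ = q ^ j * ((D + θ * A') * u ^ (k + 1)) := by
              simp only [D, mul_pow]; ring
          _ ≤ q ^ j * ((q * A') * u ^ (k + 1)) := by gcongr
          _ = q ^ (j + 1) * (A' * u ^ (k + 1)) := by ring
          _ ≤ _ := by gcongr; linarith
  refine ⟨A + A', by positivity, fun j => ?_⟩
  filter_upwards [main j] with y hy
  refine hy.trans ?_
  set u := lam ^ j * ‖y - x‖
  have hu : 0 ≤ u := by positivity
  have h1 : 1 ≤ (1 + u) ^ (k + 1) := one_le_pow₀ (by linarith)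
  have h2 : u ^ (k + 1) ≤ (1 + u) ^ (k + 1) := by gcongr; linarith
  calc q ^ j * (A + A' * u ^ (k + 1)) ≤ q ^ j * (A * (1 + u) ^ (k + 1) +
        A' * (1 + u) ^ (k + 1)) := by
        gcongr
        exact le_mul_of_one_le_right hA h1
    _ = _ := by ring

/-- The scale λ^(-j) is comparable with max(λ^(-l), d): j = l when d ≤ λ^(-l), otherwise λ^j ≤ 1/d <
λ^(j+1). -/
lemma exists_scale (hlam : 1 < lam) (l : ℕ) {d : ℝ} (hd0 : 0 ≤ d) (hd1 : d ≤ 1) :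
    ∃ j ≤ l, lam ^ j * d ≤ 1 ∧ (lam ^ j)⁻¹ ≤ lam * ((lam ^ l)⁻¹ + d) := by
  have h0 : 0 < lam := by linarith
  by_cases h : lam ^ l * d ≤ 1
  · refine ⟨l, le_rfl, h, ?_⟩
    have : 0 < (lam ^ l)⁻¹ := by positivity
    nlinarith
  · push Not at h
    have hd : 0 < d := by
      by_contra hcon
      have : d = 0 := by linarith
      simp [this] at h
      linarith
    obtain ⟨j, hj1, hj2⟩ := exists_nat_pow_near ((one_le_div hd).2 hd1) hlam
    rw [le_div_iff₀ hd] at hj1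
    rw [div_lt_iff₀ hd] at hj2
    refine ⟨j, ?_, hj1, ?_⟩
    · by_contra hcon
      push Not at hcon
      have : lam ^ l * d ≤ lam ^ j * d := by
        gcongr
        exact hlam.le
      linarith
    · rw [inv_le_iff_one_le_mul₀ (by positivity)]
      have h1 : 0 < (lam ^ l)⁻¹ := by positivity
      have h2 : 0 ≤ lam * (lam ^ l)⁻¹ * lam ^ j := by positivity
      rw [pow_succ] at hj2
      nlinarith

/-- Pointwise Hölder regularity controls the Littlewood–Paley sums and blocks. -/
lemma MemC.exists_bounds {Q₀ : Set (Vec n)} (hlam : 1 < lam) (hQ₀ : IsCompact Q₀)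
    (hQ₀' : 0 ∈ interior Q₀) {φ : SchwartzMap (Vec n) ℂ} (hφ : IsLowPass lam φ)
    (hs : 0 < s) (hk : s < k + 1) {f : Vec n → ℂ} (hf : MemLp f ∞ volume) {x : Vec n}
    (h : MemC lam Q₀ k s f x) :
    ∃ C : ℝ, 0 < C ∧
      (∀ l : ℕ, ∀ᵐ y, ‖f y - partialSum lam φ f l y‖ ≤
        C * (lam ^ (-(l : ℤ)) + ‖x - y‖) ^ s) ∧
      ∀ (l : ℕ) (y : Vec n), ‖block lam φ f l y‖ ≤
        C * (lam ^ (-(l : ℤ)) + ‖x - y‖) ^ s := by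
  have h0 : 0 < lam := by linarith
  obtain ⟨A, hA0, hA⟩ := (memC_iff hlam hQ₀).1 h
  choose P hdeg hP using hA
  obtain ⟨r, hr, hrQ⟩ := exists_ball_subset_cell hlam hQ₀' x
  obtain ⟨C, hC0, hC⟩ := exists_global_bound_sub_polyFun hlam hs hk hf hA0 hr hdeg
    fun j => (hP j).mono fun y hy hyb => hy (hrQ j hyb)
  obtain ⟨B, hB0, hB⟩ := exists_ae_norm_le_of_memLp_top hf
  have hq0 : 0 < lam ^ (-s) := rpow_neg_pos hlam s
  set I := ∫ u, ‖φ u‖ * (1 + ‖u‖) ^ (k + 1)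
  set J := ∫ u, ‖φ u‖
  have hI : 0 ≤ I := integral_nonneg fun u => by positivity
  have hJ : 0 ≤ J := integral_nonneg fun u => norm_nonneg _
  -- Reproduction of P_j writes the difference as (f - P_j) * φ_l; j ≤ l ensures that the kernel is
  -- at least as fine as the weight.
  have hsum : ∀ (j l : ℕ) (y : Vec n), j ≤ l → ‖partialSum lam φ f l y - polyFun (P j) y‖ ≤
      I * (C * (lam ^ (-s)) ^ j) * (1 + lam ^ j * ‖y - x‖) ^ (k + 1) := by
    intro j l y hjl
    obtain ⟨hi, he⟩ := hφ.conv_polyFun hlam (P j) (a := lam ^ l) (by positivity) y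
    have e : partialSum lam φ f l y - polyFun (P j) y =
        conv (fun t => f t - polyFun (P j) t) (rescale (lam ^ l) φ) y := by
      rw [← he, partialSum, dilate_eq_rescale, conv_apply, conv_apply, conv_apply,
        ← integral_sub (integrable_mul_schwartz_rescale hf φ (by positivity) y) hi]
      simp only [sub_mul]
    rw [e]
    exact norm_conv_rescale_le (integrable_schwartz_weight φ (k + 1)) (by positivity)
      (by positivity) (pow_le_pow_right₀ hlam.le hjl) (by positivity) (hC j) y
  have hscale : ∀ (j l : ℕ) (y : Vec n),
      (lam ^ j)⁻¹ ≤ lam * ((lam ^ l)⁻¹ + ‖x - y‖) →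
      (lam ^ (-s)) ^ j ≤ lam ^ s * (lam ^ (-(l : ℤ)) + ‖x - y‖) ^ s := by
    intro j l y hj
    have e : (lam ^ (-s)) ^ j = ((lam ^ j)⁻¹) ^ s := by
      rw [← Real.rpow_natCast, ← Real.rpow_mul h0.le, ← Real.rpow_natCast,
        ← Real.rpow_neg h0.le, ← Real.rpow_mul h0.le]
      congr 1
      ring
    rw [e, zpow_neg, zpow_natCast, ← Real.mul_rpow h0.le (by positivity)]
    exact Real.rpow_le_rpow (by positivity) hj hs.le
  have hnear : ∀ (j : ℕ) (y : Vec n), lam ^ j * ‖x - y‖ ≤ 1 →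
      1 + lam ^ j * ‖y - x‖ ≤ 2 := by
    intro j y hj
    rw [norm_sub_rev]
    linarith
  -- When |x - y| > 1 the majorant is at least 1, so boundedness of f suffices.
  have hfar : ∀ (l : ℕ) (y : Vec n), 1 < ‖x - y‖ →
      1 ≤ (lam ^ (-(l : ℤ)) + ‖x - y‖) ^ s := by
    intro l y hy
    have : 0 < lam ^ (-(l : ℤ)) := by positivity
    exact Real.one_le_rpow (by linarith) hs.le
  have hls : 0 < lam ^ s := Real.rpow_pos_of_pos h0 _
  -- Both constants serve f - S_l f and the block at once: near x the errors are C + IC and 2IC, far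
  -- from x they are B + JB and 2JB.
  set C₁ := (C + 2 * (I * C)) * 2 ^ (k + 1) * lam ^ s
  set C₂ := B + 2 * (J * B)
  have hC₁ : 0 ≤ C₁ := by positivity
  have hC₂ : 0 ≤ C₂ := by positivity
  have near_bound : ∀ (j l : ℕ) (y : Vec n) (a : ℝ), lam ^ j * ‖x - y‖ ≤ 1 →
      (lam ^ j)⁻¹ ≤ lam * ((lam ^ l)⁻¹ + ‖x - y‖) →
      a ≤ (C + 2 * (I * C)) * (lam ^ (-s)) ^ j * (1 + lam ^ j * ‖y - x‖) ^ (k + 1) →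
      a ≤ (C₁ + C₂ + 1) * (lam ^ (-(l : ℤ)) + ‖x - y‖) ^ s := by
    intro j l y a h1 h2 h3
    have hp : 0 ≤ (lam ^ (-(l : ℤ)) + ‖x - y‖) ^ s := by positivity
    calc a ≤ (C + 2 * (I * C)) * (lam ^ s * (lam ^ (-(l : ℤ)) + ‖x - y‖) ^ s) *
          2 ^ (k + 1) := by
          refine h3.trans ?_
          gcongr
          · exact hscale j l y h2
          · exact hnear j y h1
      _ = C₁ * (lam ^ (-(l : ℤ)) + ‖x - y‖) ^ s := by simp only [C₁]; ring
      _ ≤ _ := by gcongr; linarith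
  clear_value C₁
  have far_bound : ∀ (l : ℕ) (y : Vec n) (a : ℝ), 1 < ‖x - y‖ → a ≤ C₂ →
      a ≤ (C₁ + C₂ + 1) * (lam ^ (-(l : ℤ)) + ‖x - y‖) ^ s := by
    intro l y a h1 h2
    calc a ≤ (C₁ + C₂ + 1) * 1 := by linarith
      _ ≤ _ := mul_le_mul_of_nonneg_left (hfar l y h1) (by linarith)
  refine ⟨C₁ + C₂ + 1, by linarith, fun l => ?_, fun l y => ?_⟩
  · filter_upwards [ae_all_iff.2 hC, hB] with y hy hBy
    by_cases hd : ‖x - y‖ ≤ 1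
    · obtain ⟨j, hjl, hj1, hj2⟩ := exists_scale hlam l (norm_nonneg (x - y)) hd
      refine near_bound j l y _ hj1 hj2 ?_
      have h1 := hy j
      have h2 := hsum j l y hjl
      have h3 := norm_sub_le (f y - polyFun (P j) y) (partialSum lam φ f l y - polyFun (P j) y)
      rw [sub_sub_sub_cancel_right] at h3
      have h4 : 0 ≤ I * (C * (lam ^ (-s)) ^ j) * (1 + lam ^ j * ‖y - x‖) ^ (k + 1) := by
        positivity
      linarith
    · push Not at hd
      refine far_bound l y _ hd ?_
      have h1 := norm_partialSum_le hB0 hB φ hlam l y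
      have h2 := norm_sub_le (f y) (partialSum lam φ f l y)
      have h3 : 0 ≤ J * B := by positivity
      linarith
  · rw [block_eq hf φ hlam]
    by_cases hd : ‖x - y‖ ≤ 1
    · obtain ⟨j, hjl, hj1, hj2⟩ := exists_scale hlam l (norm_nonneg (x - y)) hd
      refine near_bound j l y _ hj1 hj2 ?_
      have h1 := hsum j (l + 1) y (by omega)
      have h2 := hsum j l y hjl
      have h3 := norm_sub_le (partialSum lam φ f (l + 1) y - polyFun (P j) y)
        (partialSum lam φ f l y - polyFun (P j) y)
      rw [sub_sub_sub_cancel_right] at h3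
      have h4 : 0 ≤ C * (lam ^ (-s)) ^ j * (1 + lam ^ j * ‖y - x‖) ^ (k + 1) := by positivity
      linarith
    · push Not at hd
      refine far_bound l y _ hd ?_
      have h1 := norm_partialSum_le hB0 hB φ hlam l y
      have h1' := norm_partialSum_le hB0 hB φ hlam (l + 1) y
      have h2 := norm_sub_le (partialSum lam φ f (l + 1) y) (partialSum lam φ f l y)
      linarith

end forward

/-! ### From Littlewood–Paley bounds to pointwise regularity. -/

section backward

variable {n : ℕ} {lam s : ℝ} {k : ℕ}

/-- The sums satisfy σ_{l+1} = θ(σ_l + q^l), and c = θ/(q - θ) is the constant with θ(c + 1) = cq.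
-/
lemma sum_geometric_convolution_le {q θ : ℝ} (hθ : 0 < θ) (hθq : θ < q) (l : ℕ) :
    ∑ j ∈ Finset.range l, q ^ j * θ ^ (l - j) ≤ θ / (q - θ) * q ^ l := by
  have h0 : 0 < q - θ := sub_pos.2 hθq
  have hq : 0 < q := hθ.trans hθq
  induction l with
  | zero => simp; positivity
  | succ l ih =>
    have e : ∑ j ∈ Finset.range (l + 1), q ^ j * θ ^ (l + 1 - j) =
        θ * (∑ j ∈ Finset.range l, q ^ j * θ ^ (l - j) + q ^ l) := by
      rw [Finset.sum_range_succ, mul_add, Finset.mul_sum]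
      congr 1
      · refine Finset.sum_congr rfl fun j hj => ?_
        rw [Nat.succ_sub (Finset.mem_range.1 hj).le, pow_succ]
        ring
      · simp; ring
    rw [e]
    calc θ * (∑ j ∈ Finset.range l, q ^ j * θ ^ (l - j) + q ^ l)
        ≤ θ * (θ / (q - θ) * q ^ l + q ^ l) := by gcongr
      _ = θ / (q - θ) * q ^ (l + 1) := by field_simp; ring

lemma partialSum_eq_add_sum_block {f : Vec n → ℂ} (hf : MemLp f ∞ volume)
    (φ : SchwartzMap (Vec n) ℂ) (hlam : 1 < lam) (l : ℕ) (y : Vec n) :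
    partialSum lam φ f l y =
      partialSum lam φ f 0 y + ∑ j ∈ Finset.range l, block lam φ f j y := by
  simp_rw [block_eq hf φ hlam]
  rw [Finset.sum_range_sub (fun j => partialSum lam φ f j y)]
  ring

/-- Littlewood–Paley sums with controlled blocks have local polynomial approximations. -/
lemma exists_poly_near_partialSum (hlam : 1 < lam) {φ : SchwartzMap (Vec n) ℂ}
    (hφ : IsLowPass lam φ) (hk : s < k + 1) {f : Vec n → ℂ}
    (hf : MemLp f ∞ volume) {x : Vec n} {C₁ R : ℝ} (hC₁ : 0 ≤ C₁) (hR : 0 ≤ R)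
    (h : ∀ l, ∀ᵐ y, ‖block lam φ f l y‖ ≤
      C₁ * (lam ^ (-s)) ^ l * (1 + lam ^ l * ‖y - x‖) ^ (k + 1)) :
    ∃ C : ℝ, 0 ≤ C ∧ ∀ l, ∃ P : MvPolynomial (Fin n) ℂ, P.totalDegree ≤ k ∧
      ∀ y, lam ^ l * ‖y - x‖ ≤ R →
        ‖partialSum lam φ f l y - polyFun P y‖ ≤ C * (lam ^ (-s)) ^ l := by
  have h0 : 0 < lam := by linarith
  set q := lam ^ (-s)
  set θ := (lam ^ (k + 1))⁻¹
  have hq0 : 0 < q := rpow_neg_pos hlam s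
  have hθ0 : 0 < θ := by positivity
  have hθq : θ < q := inv_pow_lt_rpow_neg hlam hk
  obtain ⟨B, hB0, hB⟩ := exists_ae_norm_le_of_memLp_top hf
  -- Block j is expanded at scale λ^(j+2), hence the enlarged radius λ²R.
  obtain ⟨T, hT0, hT⟩ := exists_poly_near_conv_rescale φ k (k + 1) (R := lam ^ 2 * R)
    (by positivity)
  -- The case a = 1 treats the low-frequency term S_0 f, using only the boundedness of f.
  obtain ⟨P₀, hP₀, hP₀'⟩ := hT f 1 B x hf.1 one_pos hB0 (by
    filter_upwards [hB] with t ht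
    exact ht.trans (le_mul_of_one_le_right hB0
      (one_le_pow₀ (by linarith [mul_nonneg zero_le_one (norm_nonneg (t - x))]))))
  have hblock : ∀ j : ℕ, ∃ P : MvPolynomial (Fin n) ℂ, P.totalDegree ≤ k ∧ ∀ y,
      lam ^ (j + 2) * ‖y - x‖ ≤ lam ^ 2 * R → ‖block lam φ f j y - polyFun P y‖ ≤
        T * (C₁ * q ^ j) * (lam ^ (j + 2) * ‖y - x‖) ^ (k + 1) := by
    intro j
    obtain ⟨P, hP, hP'⟩ := hT (block lam φ f j) (lam ^ (j + 2)) (C₁ * q ^ j) x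
      (memLp_block hf φ hlam j).1 (by positivity) (by positivity) (by
        filter_upwards [h j] with t ht
        refine ht.trans ?_
        gcongr
        · exact hlam.le
        · omega)
    refine ⟨P, hP, fun y hy => ?_⟩
    rw [hφ.block_eq_conv hlam hf]
    exact hP' y hy
  choose P hP hP' using hblock
  have hθpow : ∀ i : ℕ, ((lam ^ i)⁻¹) ^ (k + 1) = θ ^ i := by
    intro i
    simp only [θ, inv_pow, ← pow_mul]
    rw [mul_comm]
  refine ⟨T * B * R ^ (k + 1) + T * C₁ * (lam ^ 2 * R) ^ (k + 1) * (θ / (q - θ)), ?_,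
    fun l => ⟨P₀ + ∑ j ∈ Finset.range l, P j, ?_, fun y hy => ?_⟩⟩
  · have := sub_pos.2 hθq
    positivity
  · refine (MvPolynomial.totalDegree_add _ _).trans (max_le hP₀ ?_)
    exact MvPolynomial.totalDegree_finsetSum_le fun j _ => hP j
  have hd : ‖y - x‖ ≤ (lam ^ l)⁻¹ * R := by
    rw [inv_mul_eq_div, le_div_iff₀ (by positivity)]
    linarith
  have hmono : ∀ j ≤ l, lam ^ j * ‖y - x‖ ≤ (lam ^ (l - j))⁻¹ * R := by
    intro j hj
    calc lam ^ j * ‖y - x‖ ≤ lam ^ j * ((lam ^ l)⁻¹ * R) := by gcongr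
      _ = (lam ^ (l - j))⁻¹ * R := by
        have : lam ^ l = lam ^ j * lam ^ (l - j) := by rw [← pow_add]; congr 1; omega
        rw [this]
        field_simp
  have hinv : ∀ i : ℕ, (lam ^ i)⁻¹ ≤ 1 := fun i => inv_le_one_of_one_le₀ (one_le_pow₀ hlam.le)
  have hdR : ∀ j ≤ l, lam ^ j * ‖y - x‖ ≤ R := fun j hj =>
    (hmono j hj).trans (mul_le_of_le_one_left hR (hinv _))
  have b0 : ‖partialSum lam φ f 0 y - polyFun P₀ y‖ ≤ T * B * R ^ (k + 1) * q ^ l := by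
    rw [partialSum, dilate_eq_rescale, pow_zero]
    have h1 : 1 * ‖y - x‖ ≤ (lam ^ l)⁻¹ * R := by
      simpa using hmono 0 (Nat.zero_le l)
    have h2 : 1 * ‖y - x‖ ≤ lam ^ 2 * R := by
      have := hdR 0 (Nat.zero_le l)
      rw [pow_zero] at this
      exact this.trans (le_mul_of_one_le_left hR (one_le_pow₀ hlam.le))
    calc _ ≤ T * B * (1 * ‖y - x‖) ^ (k + 1) := hP₀' y h2
      _ ≤ T * B * ((lam ^ l)⁻¹ * R) ^ (k + 1) := by gcongr
      _ = T * B * R ^ (k + 1) * θ ^ l := by rw [mul_pow, hθpow]; ring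
      _ ≤ _ := by gcongr
  -- The l-th cell is smaller than the scale of block j by λ^(l-j), so the Taylor remainder gains
  -- θ^(l-j).
  have bj : ∀ j ∈ Finset.range l, ‖block lam φ f j y - polyFun (P j) y‖ ≤
      T * C₁ * (lam ^ 2 * R) ^ (k + 1) * (q ^ j * θ ^ (l - j)) := by
    intro j hj
    have hjl := (Finset.mem_range.1 hj).le
    have e : lam ^ (j + 2) * ‖y - x‖ = lam ^ 2 * (lam ^ j * ‖y - x‖) := by ring
    have h2 : lam ^ (j + 2) * ‖y - x‖ ≤ lam ^ 2 * R := by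
      rw [e]
      gcongr
      exact hdR j hjl
    refine (hP' j y h2).trans ?_
    rw [e]
    calc _ ≤ T * (C₁ * q ^ j) * (lam ^ 2 * ((lam ^ (l - j))⁻¹ * R)) ^ (k + 1) := by
          have := hmono j hjl
          set u := lam ^ j * ‖y - x‖
          gcongr
      _ = _ := by
          rw [mul_pow, mul_pow ((lam ^ (l - j))⁻¹), hθpow, mul_pow (lam ^ 2)]
          ring
  rw [partialSum_eq_add_sum_block hf φ hlam, polyFun_add, polyFun_sum, add_sub_add_comm,
    ← Finset.sum_sub_distrib]
  calc _ ≤ T * B * R ^ (k + 1) * q ^ l +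
        ∑ j ∈ Finset.range l, T * C₁ * (lam ^ 2 * R) ^ (k + 1) * (q ^ j * θ ^ (l - j)) :=
        (norm_add_le _ _).trans (add_le_add b0 ((norm_sum_le _ _).trans (Finset.sum_le_sum bj)))
    _ ≤ T * B * R ^ (k + 1) * q ^ l +
        T * C₁ * (lam ^ 2 * R) ^ (k + 1) * (θ / (q - θ) * q ^ l) := by
        rw [← Finset.mul_sum]
        gcongr
        exact sum_geometric_convolution_le hθ0 hθq l
    _ = _ := by ring

/-- Controlled blocks and local convergence rates imply pointwise Hölder regularity. -/
lemma memC_of_block_bounds {Q₀ : Set (Vec n)} (hlam : 1 < lam) (hQ₀ : IsCompact Q₀)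
    {φ : SchwartzMap (Vec n) ℂ} (hφ : IsLowPass lam φ)
    (hk : s < k + 1) {f : Vec n → ℂ} (hf : MemLp f ∞ volume) {x : Vec n}
    {C₁ : ℝ} (hC₁ : 0 ≤ C₁)
    (h : ∀ l, ∀ᵐ y, ‖block lam φ f l y‖ ≤
      C₁ * (lam ^ (-s)) ^ l * (1 + lam ^ l * ‖y - x‖) ^ (k + 1))
    (h' : ∀ R : ℝ, 0 ≤ R → ∃ C : ℝ, 0 ≤ C ∧ ∀ l : ℕ, ∀ᵐ y, lam ^ l * ‖y - x‖ ≤ R →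
      ‖f y - partialSum lam φ f l y‖ ≤ C * (lam ^ (-s)) ^ l) :
    MemC lam Q₀ k s f x := by
  obtain ⟨R, hR0, hR⟩ := exists_cell_subset_closedBall hlam hQ₀ x
  obtain ⟨C, hC0, hC⟩ := exists_poly_near_partialSum hlam hφ hk hf hC₁ hR0 h
  obtain ⟨C', hC'0, hC'⟩ := h' R hR0
  refine (memC_iff hlam hQ₀).2 ⟨C + C', by positivity, fun l => ?_⟩
  obtain ⟨P, hP, hP'⟩ := hC l
  refine ⟨P, hP, ?_⟩
  filter_upwards [hC' l] with y hy hyc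
  have h1 := hy (hR l y hyc)
  have h2 := hP' y (hR l y hyc)
  have h3 := norm_add_le (f y - partialSum lam φ f l y) (partialSum lam φ f l y - polyFun P y)
  rw [sub_add_sub_cancel] at h3
  linarith

end backward

/-! ### Weak convergence of the partial sums. -/

section approximate_identity

variable {n : ℕ}

lemma exists_decay_of_hasCompactSupport {g : Vec n → ℝ} (hg : Continuous g)
    (hgc : HasCompactSupport g) :
    ∃ M : ℝ, 0 ≤ M ∧ ∀ v, ‖g v‖ ≤ M * ((1 + ‖v‖) ^ (n + 1))⁻¹ := by
  have hc : HasCompactSupport fun v => g v * (1 + ‖v‖) ^ (n + 1) := hgc.mul_right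
  obtain ⟨M, hM⟩ := hc.exists_bound_of_continuous (by fun_prop)
  refine ⟨M, (norm_nonneg _).trans (hM 0), fun v => ?_⟩
  have := hM v
  rw [norm_mul, Real.norm_of_nonneg (by positivity : 0 ≤ (1 + ‖v‖) ^ (n + 1))] at this
  rw [← div_eq_mul_inv, le_div_iff₀ (by positivity)]
  exact this

/-- By Fubini the smoothing passes from f, which is only bounded, to the continuous test function.
-/
lemma integral_smul_conv_eq {f : Vec n → ℂ} (hf : MemLp f ∞ volume)
    (φ : SchwartzMap (Vec n) ℂ) {a : ℝ} (ha : 0 < a) {g : Vec n → ℝ} (hg : Continuous g)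
    (hgc : HasCompactSupport g) :
    ∫ y, g y • conv f (rescale a φ) y = ∫ t, f t * ∫ w, (g (t + a⁻¹ • w) : ℂ) * φ w := by
  obtain ⟨B, hB0, hB⟩ := exists_ae_norm_le_of_memLp_top hf
  have hgi : Integrable fun y => (g y : ℂ) :=
    (hg.integrable_of_hasCompactSupport hgc).ofReal
  have hφi : Integrable (rescale a φ) := by
    obtain ⟨Φ, hΦ⟩ := exists_schwartz_rescale φ ha
    rw [← hΦ]
    exact Φ.integrable
  have hprod : Integrable (Function.uncurry fun t y : Vec n =>
      f t * ((g y : ℂ) * rescale a φ (y - t))) (volume.prod volume) := by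
    have h1 := hgi.convolution_integrand (ContinuousLinearMap.mul ℂ ℂ) hφi.comp_neg
    refine Integrable.bdd_mul (c := B) (h1.congr ?_) hf.1.comp_fst ?_
    · exact Eventually.of_forall fun p => by simp
    · exact Measure.quasiMeasurePreserving_fst.ae hB
  calc ∫ y, g y • conv f (rescale a φ) y
      = ∫ y, ∫ t, f t * ((g y : ℂ) * rescale a φ (y - t)) := by
        refine integral_congr_ae (Eventually.of_forall fun y => ?_)
        simp only [conv_apply]
        rw [← integral_smul]
        refine integral_congr_ae (Eventually.of_forall fun t => ?_)
        simp only [Complex.real_smul]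
        ring
    _ = ∫ t, ∫ y, f t * ((g y : ℂ) * rescale a φ (y - t)) := (integral_integral_swap hprod).symm
    _ = _ := by
        refine integral_congr_ae (Eventually.of_forall fun t => ?_)
        simp only
        rw [integral_const_mul]
        congr 1
        rw [← integral_rescale ha (-t) fun w => (g (t + a⁻¹ • w) : ℂ) * φ w,
          ← integral_neg_eq_self fun y => (g y : ℂ) * rescale a φ (y - t)]
        refine integral_congr_ae (Eventually.of_forall fun y => ?_)
        have e : t + a⁻¹ • a • (-t - y) = -y := by
          rw [smul_smul, inv_mul_cancel₀ ha.ne', one_smul]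
          abel
        have e' : -y - t = -t - y := by abel
        simp only [e, e', rescale, Complex.real_smul]
        push_cast
        ring

/-- The smoothed test function tends to g pointwise, with an integrable majorant independent of m;
dominated convergence is used in the inner and the outer integral. -/
lemma tendsto_integral_smul_conv {f : Vec n → ℂ} (hf : MemLp f ∞ volume)
    (φ : SchwartzMap (Vec n) ℂ) (hφ : ∫ u, φ u = 1) {a : ℕ → ℝ} (ha : ∀ m, 1 ≤ a m)
    (hat : Tendsto a atTop atTop) {g : Vec n → ℝ} (hg : Continuous g)
    (hgc : HasCompactSupport g) :
    Tendsto (fun m => ∫ y, g y • conv f (rescale (a m) φ) y) atTop (𝓝 (∫ y, g y • f y)) := by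
  obtain ⟨B, hB0, hB⟩ := exists_ae_norm_le_of_memLp_top hf
  obtain ⟨M, hM0, hM⟩ := exists_decay_of_hasCompactSupport hg hgc
  obtain ⟨M', hM'⟩ := hgc.exists_bound_of_continuous hg
  have ha0 : ∀ m, 0 < a m := fun m => zero_lt_one.trans_le (ha m)
  simp_rw [fun m => integral_smul_conv_eq hf φ (ha0 m) hg hgc]
  set I := ∫ w, ‖φ w‖ * (1 + ‖w‖) ^ (n + 1)
  have hinner : ∀ m t, ‖∫ w, (g (t + (a m)⁻¹ • w) : ℂ) * φ w‖ ≤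
      M * ((1 + ‖t‖) ^ (n + 1))⁻¹ * I := by
    intro m t
    refine (norm_integral_le_of_norm_le ((integrable_schwartz_weight φ (n + 1)).const_mul
      (M * ((1 + ‖t‖) ^ (n + 1))⁻¹)) (Eventually.of_forall fun w => ?_)).trans_eq
      (integral_const_mul _ _)
    rw [norm_mul, Complex.norm_real]
    set v := t + (a m)⁻¹ • w
    -- Because a_m ≥ 1, the shift is at most |w|, so the decay of g at v passes to t uniformly in m.
    have h1 : 1 + ‖t‖ ≤ (1 + ‖v‖) * (1 + ‖w‖) := by
      have e1 : ‖(a m)⁻¹ • w‖ ≤ ‖w‖ := by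
        rw [norm_smul, norm_inv, Real.norm_of_nonneg (ha0 m).le]
        exact mul_le_of_le_one_left (norm_nonneg _) (inv_le_one_of_one_le₀ (ha m))
      have e2 : ‖t‖ ≤ ‖v‖ + ‖(a m)⁻¹ • w‖ := by
        simpa [v] using norm_sub_le v ((a m)⁻¹ • w)
      nlinarith [mul_nonneg (norm_nonneg v) (norm_nonneg w)]
    calc ‖g v‖ * ‖φ w‖ ≤ M * ((1 + ‖v‖) ^ (n + 1))⁻¹ * ‖φ w‖ := by gcongr; exact hM v
      _ ≤ M * (((1 + ‖t‖) ^ (n + 1))⁻¹ * (1 + ‖w‖) ^ (n + 1)) * ‖φ w‖ := by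
        gcongr
        rw [inv_mul_eq_div, inv_le_iff_one_le_mul₀ (by positivity), div_mul_eq_mul_div,
          one_le_div (by positivity), ← mul_pow]
        gcongr
        rwa [mul_comm]
      _ = _ := by ring
  refine tendsto_integral_of_dominated_convergence
    (fun t => B * (M * ((1 + ‖t‖) ^ (n + 1))⁻¹ * I)) (fun m => ?_) ?_ (fun m => ?_) ?_
  · refine hf.1.mul ?_
    have hm : AEStronglyMeasurable (Function.uncurry fun t w : Vec n =>
        (g (t + (a m)⁻¹ • w) : ℂ) * φ w) (volume.prod volume) := by
      refine Continuous.aestronglyMeasurable ?_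
      refine (Complex.continuous_ofReal.comp (hg.comp ?_)).mul (φ.continuous.comp continuous_snd)
      fun_prop
    exact hm.integral_prod_right'
  · exact ((integrable_inv_one_add_norm_pow.const_mul M).mul_const I).const_mul B
  · filter_upwards [hB] with t ht
    rw [norm_mul]
    gcongr
    exact hinner m t
  · refine Eventually.of_forall fun t => ?_
    rw [Complex.real_smul, mul_comm (g t : ℂ)]
    refine Tendsto.const_mul _ ?_
    have hlim : (g t : ℂ) = ∫ w, (g t : ℂ) * φ w := by
      rw [integral_const_mul, hφ, mul_one]
    rw [hlim]
    refine tendsto_integral_of_dominated_convergence (fun w => M' * ‖φ w‖) (fun m => ?_)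
      (φ.integrable.norm.const_mul M') (fun m => Eventually.of_forall fun w => ?_)
      (Eventually.of_forall fun w => ?_)
    · refine Continuous.aestronglyMeasurable ?_
      refine (Complex.continuous_ofReal.comp (hg.comp ?_)).mul φ.continuous
      fun_prop
    · rw [norm_mul, Complex.norm_real]
      gcongr
      exact hM' _
    · refine Tendsto.mul_const _ ?_
      refine (Complex.continuous_ofReal.tendsto _).comp ((hg.tendsto _).comp ?_)
      have h1 : Tendsto (fun m => (a m)⁻¹) atTop (𝓝 0) := tendsto_inv_atTop_zero.comp hat
      simpa using (tendsto_const_nhds (x := t)).add (h1.smul_const w)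

/-- A pointwise limit of the smoothed functions agrees with the function. -/
lemma ae_eq_of_tendsto_partialSum {lam : ℝ} (hlam : 1 < lam) {φ : SchwartzMap (Vec n) ℂ}
    (hφ : ∫ u, φ u = 1) {f G : Vec n → ℂ} (hf : MemLp f ∞ volume)
    (hG : ∀ y, Tendsto (fun m => partialSum lam φ f m y) atTop (𝓝 (G y))) : f =ᵐ[volume] G := by
  have h0 : 0 < lam := by linarith
  obtain ⟨B, hB0, hB⟩ := exists_ae_norm_le_of_memLp_top hf
  have hbound := norm_partialSum_le hB0 hB φ hlam
  have hmeas := aestronglyMeasurable_partialSum hf φ hlam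
  have hGm : MemLp G ∞ volume := by
    refine memLp_top_of_bound (aestronglyMeasurable_of_tendsto_ae atTop hmeas
      (Eventually.of_forall hG)) ((∫ u, ‖φ u‖) * B) (Eventually.of_forall fun y => ?_)
    exact le_of_tendsto (hG y).norm (Eventually.of_forall fun m => hbound m y)
  refine ae_eq_of_integral_contDiff_smul_eq (hf.locallyIntegrable le_top)
    (hGm.locallyIntegrable le_top) fun g hg hgc => ?_
  have h1 := tendsto_integral_smul_conv hf φ hφ (a := fun m => lam ^ m)
    (fun m => one_le_pow₀ hlam.le) (tendsto_pow_atTop_atTop_of_one_lt hlam) hg.continuous hgc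
  have h2 : Tendsto (fun m => ∫ y, g y • partialSum lam φ f m y) atTop
      (𝓝 (∫ y, g y • G y)) := by
    refine tendsto_integral_of_dominated_convergence (fun y => ‖g y‖ * ((∫ u, ‖φ u‖) * B))
      (fun m => hg.continuous.aestronglyMeasurable.smul (hmeas m)) ?_
      (fun m => Eventually.of_forall fun y => ?_)
      (Eventually.of_forall fun y => (hG y).const_smul _)
    · exact (hg.continuous.integrable_of_hasCompactSupport hgc).norm.mul_const _
    · rw [norm_smul]
      gcongr
      exact hbound m y
  -- Weak and pointwise limits give f and G the same integral against every smooth test function.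
  refine tendsto_nhds_unique h1 (h2.congr fun m => ?_)
  simp only [partialSum, dilate_eq_rescale]

end approximate_identity

/-! ### The two converse statements. -/

section main

variable {n : ℕ} {lam s : ℝ} {k : ℕ}

lemma IsLowPass.integral_eq_one (hlam : 1 < lam) {φ : SchwartzMap (Vec n) ℂ}
    (hφ : IsLowPass lam φ) : ∫ u, φ u = 1 := by
  have := (hφ.integral_polyFun_mul hlam 1).2
  simpa [polyFun] using this

lemma rpow_neg_pow (hlam : 1 < lam) (s : ℝ) (l : ℕ) :
    (lam ^ (-s)) ^ l = lam ^ (-((l : ℝ) * s)) := by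
  rw [← Real.rpow_natCast, ← Real.rpow_mul (by linarith)]
  congr 1
  ring

lemma zpow_neg_add_rpow_eq (hlam : 1 < lam) (s : ℝ) (l : ℕ) {d : ℝ} (hd : 0 ≤ d) :
    (lam ^ (-(l : ℤ)) + d) ^ s = (lam ^ (-s)) ^ l * (1 + lam ^ l * d) ^ s := by
  have h0 : 0 < lam := by linarith
  have e : lam ^ (-(l : ℤ)) + d = lam ^ (-(l : ℝ)) * (1 + lam ^ l * d) := by
    rw [zpow_neg, zpow_natCast, Real.rpow_neg h0.le, Real.rpow_natCast]
    field_simp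
  rw [e, Real.mul_rpow (by positivity) (by positivity), rpow_neg_pow hlam, ← Real.rpow_mul h0.le]
  congr 2
  ring

lemma one_add_rpow_le_pow {t : ℝ} (hk : t < k + 1) {u : ℝ} (hu : 0 ≤ u) :
    (1 + u) ^ t ≤ (1 + u) ^ (k + 1) := by
  rw [← Real.rpow_natCast]
  apply Real.rpow_le_rpow_of_exponent_le (by linarith)
  push_cast
  exact hk.le

/-- The rate of convergence of the Littlewood–Paley sums characterizes pointwise regularity. -/
lemma memC_of_partialSum_bounds {Q₀ : Set (Vec n)} (hlam : 1 < lam) (hQ₀ : IsCompact Q₀)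
    {φ : SchwartzMap (Vec n) ℂ} (hφ : IsLowPass lam φ) (hs : 0 < s)
    (hk : s < k + 1) {f : Vec n → ℂ} (hf : MemLp f ∞ volume) {x : Vec n} {C : ℝ} (hC : 0 < C)
    (h : ∀ l : ℕ, ∀ᵐ y, ‖f y - partialSum lam φ f l y‖ ≤
      C * (lam ^ (-(l : ℤ)) + ‖x - y‖) ^ s) : MemC lam Q₀ k s f x := by
  have h0 : 0 < lam := by linarith
  have hq0 : 0 < lam ^ (-s) := rpow_neg_pos hlam s
  refine memC_of_block_bounds hlam hQ₀ hφ hk hf (C₁ := 2 * C) (by positivity) (fun l => ?_)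
    fun R hR => ⟨C * (1 + R) ^ s, by positivity, fun l => ?_⟩
  · filter_upwards [h l, h (l + 1)] with y h1 h2
    have h3 : C * (lam ^ (-((l + 1 : ℕ) : ℤ)) + ‖x - y‖) ^ s ≤
        C * (lam ^ (-(l : ℤ)) + ‖x - y‖) ^ s := by
      gcongr
      · exact hlam.le
      · omega
    -- The block is (f - S_l f) - (f - S_{l+1} f), whence the constant 2C.
    have h4 := norm_sub_le (f y - partialSum lam φ f l y) (f y - partialSum lam φ f (l + 1) y)
    rw [sub_sub_sub_cancel_left, ← block_eq hf φ hlam] at h4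
    have h5 : (lam ^ (-(l : ℤ)) + ‖x - y‖) ^ s ≤
        (lam ^ (-s)) ^ l * (1 + lam ^ l * ‖y - x‖) ^ (k + 1) := by
      rw [zpow_neg_add_rpow_eq hlam s l (norm_nonneg _), norm_sub_rev]
      gcongr
      exact one_add_rpow_le_pow hk (by positivity)
    calc _ ≤ 2 * C * (lam ^ (-(l : ℤ)) + ‖x - y‖) ^ s := by linarith
      _ ≤ 2 * C * ((lam ^ (-s)) ^ l * (1 + lam ^ l * ‖y - x‖) ^ (k + 1)) := by gcongr
      _ = _ := by ring
  · filter_upwards [h l] with y h1 hy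
    refine h1.trans ?_
    rw [zpow_neg_add_rpow_eq hlam s l (norm_nonneg _), norm_sub_rev, mul_comm ((lam ^ (-s)) ^ l),
      ← mul_assoc]
    gcongr

/-- Decay of the Littlewood–Paley blocks with a slightly smaller spatial growth implies pointwise
regularity. -/
lemma memC_of_block_decay {Q₀ : Set (Vec n)} (hlam : 1 < lam) (hQ₀ : IsCompact Q₀)
    {φ : SchwartzMap (Vec n) ℂ} (hφ : IsLowPass lam φ)
    (hk : s < k + 1) {f : Vec n → ℂ} (hf : MemLp f ∞ volume) {x : Vec n} {s' : ℝ}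
    (hs' : 0 < s') (hs's : s' < s) {C : ℝ} (hC : 0 < C)
    (h : ∀ (l : ℕ) (y : Vec n), ‖block lam φ f l y‖ ≤
      C * lam ^ (-((l : ℝ) * s)) * (1 + lam ^ l * ‖x - y‖) ^ s') : MemC lam Q₀ k s f x := by
  have h0 : 0 < lam := by linarith
  have hq0 : 0 < lam ^ (-s) := rpow_neg_pos hlam s
  -- Going up one level gains λ^(-s) and loses at most λ^(s') through the spatial weight, so s' < s
  -- makes the tail geometric.
  set ρ := lam ^ (s' - s)
  have hρ1 : ρ < 1 := Real.rpow_lt_one_of_one_lt_of_neg hlam (by linarith)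
  have hρ0 : 0 < ρ := Real.rpow_pos_of_pos h0 _
  have htail : ∀ (R : ℝ) (l i : ℕ) (y : Vec n), 0 ≤ R → lam ^ l * ‖y - x‖ ≤ R →
      dist (partialSum lam φ f (l + i) y) (partialSum lam φ f (l + (i + 1)) y) ≤
        C * (1 + R) ^ s' * (lam ^ (-s)) ^ l * ρ ^ i := by
    intro R l i y hR hy
    rw [dist_comm, dist_eq_norm, ← add_assoc, ← block_eq hf φ hlam]
    have h1 : (1 + lam ^ (l + i) * ‖x - y‖) ^ s' ≤ (lam ^ s') ^ i * (1 + R) ^ s' := by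
      have e : 1 + lam ^ (l + i) * ‖x - y‖ ≤ lam ^ i * (1 + R) := by
        have e1 : 1 ≤ lam ^ i := one_le_pow₀ hlam.le
        rw [norm_sub_rev, pow_add]
        nlinarith
      refine (Real.rpow_le_rpow (by positivity) e hs'.le).trans_eq ?_
      rw [Real.mul_rpow (by positivity) (by positivity), ← Real.rpow_natCast, ← Real.rpow_natCast,
        ← Real.rpow_mul h0.le, ← Real.rpow_mul h0.le, mul_comm (i : ℝ)]
    have e2 : ρ ^ i = (lam ^ s') ^ i * (lam ^ (-s)) ^ i := by
      rw [← mul_pow, ← Real.rpow_add h0]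
      rfl
    calc _ ≤ C * lam ^ (-(((l + i : ℕ) : ℝ) * s)) * ((lam ^ s') ^ i * (1 + R) ^ s') := by
          refine (h (l + i) y).trans ?_
          gcongr
      _ = _ := by
          rw [← rpow_neg_pow hlam, e2, pow_add]
          ring
  have hlim : ∀ y, ∃ z, Tendsto (fun m => partialSum lam φ f m y) atTop (𝓝 z) := by
    intro y
    -- Level 0 with R = |y - x| gives convergence at every y; the limit is identified with f only
    -- almost everywhere.
    refine cauchySeq_tendsto_of_complete (cauchySeq_of_le_geometric ρ
      (C * (1 + ‖y - x‖) ^ s') hρ1 fun i => ?_)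
    simpa using htail ‖y - x‖ 0 i y (norm_nonneg _) (by simp)
  choose G hG using hlim
  have hfG := ae_eq_of_tendsto_partialSum hlam (hφ.integral_eq_one hlam) hf hG
  refine memC_of_block_bounds hlam hQ₀ hφ hk hf hC.le
    (fun l => Eventually.of_forall fun y => (h l y).trans ?_)
    fun R hR => ⟨C * (1 + R) ^ s' / (1 - ρ), ?_, fun l => ?_⟩
  · rw [rpow_neg_pow hlam, norm_sub_rev]
    gcongr
    exact one_add_rpow_le_pow (by linarith) (by positivity)
  · have := sub_pos.2 hρ1
    positivity
  · filter_upwards [hfG] with y hy hyR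
    rw [hy, ← dist_eq_norm, dist_comm]
    have ht : Tendsto (fun i => partialSum lam φ f (l + i) y) atTop (𝓝 (G y)) := by
      simpa only [add_comm l] using (tendsto_add_atTop_iff_nat l).2 (hG y)
    refine (dist_le_of_le_geometric_of_tendsto₀ ρ _ hρ1
      (fun i => htail R l i y hR hyR) ht).trans_eq ?_
    ring

end main

end PointwiseHolder

end

theorem proposition1 {n : ℕ} (lam : ℝ) (hlam : 1 < lam)
    (Q₀ : Set (EuclideanSpace ℝ (Fin n))) (hQ₀ : IsCompact Q₀) (hQ₀' : 0 ∈ interior Q₀)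
    (φ : SchwartzMap (EuclideanSpace ℝ (Fin n)) ℂ) (hφ : PointwiseHolder.IsLowPass lam φ)
    (s : ℝ) (hs : 0 < s) (k : ℕ) (hk : s < k + 1)
    (f : EuclideanSpace ℝ (Fin n) → ℂ) (hf : MemLp f ∞ volume)
    (x : EuclideanSpace ℝ (Fin n)) :
    (PointwiseHolder.MemC lam Q₀ k s f x ↔
      ∃ C : ℝ, 0 < C ∧ ∀ l : ℕ, ∀ᵐ y : EuclideanSpace ℝ (Fin n),
        ‖f y - PointwiseHolder.partialSum lam φ f l y‖ ≤
          C * (lam ^ (-(l : ℤ)) + ‖x - y‖) ^ s) ∧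
    (PointwiseHolder.MemC lam Q₀ k s f x →
      ∃ C : ℝ, 0 < C ∧ ∀ (l : ℕ) (y : EuclideanSpace ℝ (Fin n)),
        ‖PointwiseHolder.block lam φ f l y‖ ≤ C * (lam ^ (-(l : ℤ)) + ‖x - y‖) ^ s) ∧
    (∀ s' : ℝ, 0 < s' → s' < s →
      (∃ C : ℝ, 0 < C ∧ ∀ (l : ℕ) (y : EuclideanSpace ℝ (Fin n)),
        ‖PointwiseHolder.block lam φ f l y‖ ≤
          C * lam ^ (-((l : ℝ) * s)) * (1 + lam ^ l * ‖x - y‖) ^ s') →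
      PointwiseHolder.MemC lam Q₀ k s f x) := by
  refine ⟨⟨fun h => ?_, fun ⟨C, hC, h⟩ => ?_⟩, fun h => ?_, fun s' hs' hs's ⟨C, hC, h⟩ => ?_⟩
  · obtain ⟨C, hC, h1, -⟩ := h.exists_bounds hlam hQ₀ hQ₀' hφ hs hk hf
    exact ⟨C, hC, h1⟩
  · exact PointwiseHolder.memC_of_partialSum_bounds hlam hQ₀ hφ hs hk hf hC h
  · obtain ⟨C, hC, -, h2⟩ := h.exists_bounds hlam hQ₀ hQ₀' hφ hs hk hf
    exact ⟨C, hC, h2⟩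
  · exact PointwiseHolder.memC_of_block_decay hlam hQ₀ hφ hk hf hs' hs's hC h
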